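/- **Conventions.** All $C^*$-algebras below are unital and $\otimes$ is the minimal tensor product. For $N\in\mathbb N$ consider pairs $(D,M)$ of a $C^*$-algebra $D$ and a matrix $M=(m_{ij})\in M_N(D)$ whose entries generate $D$. An arrow $(D_1,M_1)\to(D_2,M_2)$ is a $^*$-homomorphism $D_1\to D_2$ that maps each entry of $M_1$ to the corresponding entry of $M_2$. A magic unitary is a matrix whose entries are projections that sum up to $1$ in every row and every column. For $M\in M_N(A)$ and $M'\in M_N(B)$ let $M\perp M'\in M_N(A\otimes B)$ be the matrix with entries $\sum_{k}m_{ik}\otimes m'_{kj}$. A pair $(D,u)$ as above is a *compact matrix quantum group* if $u$ is unitary, $(u_{ij}^*)_{ij}$ is invertible, and there is a unital $^*$-homomorphism $\Delta:D\to D\otimes D$ with $\Delta(u_{ij})=\sum_k u_{ik}\otimes u_{kj}$. Let $C(S_N^+)$ be the universal $C^*$-algebra generated by the entries of an $N\times N$ magic unitary $u_{S_N^+}$, and let $C(S_N)$ be the algebra of functions on the symmetric group $S_N$ with the matrix $u_{S_N}$ of functions $u_{ij}(\sigma)=\delta_{i,\sigma(j)}$. **Construction.** Let $N\ge 4$ and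 let $A$ be the universal unital $C^*$-algebra generated by two projections $p,q$. For pairwise different $a,b,c,d\in\{1,\dots,N\}$ let $R_{(a,b),(c,d)}\in M_N(A)$ be the matrix with entries $p$ at $(a,a),(b,b)$; $q$ at $(c,c),(d,d)$; $1$ at all other diagonal positions; $1-p$ at $(a,b),(b,a)$; $1-q$ at $(c,d),(d,c)$; and $0$ elsewhere. For every $a<b$ choose $c,d$ such that $a,b,c,d$ are pairwise different, and put $R_{(a,b),*}=R_{(a,b),(c,d)}$. Let $L$ be such that every permutation in $S_N$ is a product of at most $L$ transpositions. Let $$M_1=\Big(\mathop{\perp}_{1\le a<b\le N}R_{(a,b),*}\Big)^{\perp L}$$ (the factors being taken in any fixed order), let $B_1$ be the $C^*$-algebra generated by the entries of $M_1$, let $M_n=M_1^{\perp n}$ for $n\ge1$, and let $B_n\subseteq B_1^{\otimes n}$ be the $C^*$-algebra generated by the entries of $M_n$. Let $(B_\infty,M_\infty)$ be the inverse limit of $(B_1,M_1)\leftarrow(B_2,M_2)\leftarrow\cdots$, that is, the Hausdorff completion of the free $^*$-algebra on $N^2$ symbols with respect to the seminorm $P\mapsto\sup_{n\ge1}\|P(M_n)\|$,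 together with the matrix of the $N^2$ generators. **Statement.** For every $N\ge4$ and all choices of $L$, of the order of the factors and of the indices $c,d$, the pair $G=(B_\infty,M_\infty)$ is a compact matrix quantum group with $S_N\subsetneq G\subseteq S_N^+$: there are arrows $$(C(S_N^+),u_{S_N^+})\longrightarrow(B_\infty,M_\infty)\longrightarrow(C(S_N),u_{S_N}),$$ and the second one is not injective. -/

import Mathlib

open scoped TensorProduct

noncomputable section

namespace QPerm

/-! ### C*-seminorms on *-algebras and the associated Hausdorff completions -/

/-- A C*-seminorm on a unital complex *-algebra. -/
structure CStarSeminorm (R : Type*) [Ring R] [StarRing R] [Algebra ℂ R] where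
  toFun : R → ℝ
  add_le : ∀ x y, toFun (x + y) ≤ toFun x + toFun y
  smul : ∀ (c : ℂ) x, toFun (c • x) = ‖c‖ * toFun x
  mul_le : ∀ x y, toFun (x * y) ≤ toFun x * toFun y
  star_mul_self : ∀ x, toFun (star x * x) = toFun x * toFun x

namespace CStarSeminorm

variable {R : Type*} [Ring R] [StarRing R] [Algebra ℂ R]

theorem zero' (p : CStarSeminorm R) : p.toFun 0 = 0 := by
  simpa using p.smul 0 0

theorem neg' (p : CStarSeminorm R) (x : R) : p.toFun (-x) = p.toFun x := by
  simpa using p.smul (-1) x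

theorem nonneg (p : CStarSeminorm R) (x : R) : 0 ≤ p.toFun x := by
  have h := p.add_le x (-x)
  rw [add_neg_cancel, p.zero', p.neg'] at h
  linarith

theorem le_star (p : CStarSeminorm R) (x : R) : p.toFun x ≤ p.toFun (star x) := by
  have h := p.mul_le (star x) x
  rw [p.star_mul_self] at h
  rcases (p.nonneg x).eq_or_lt with h0 | h0
  · rw [← h0]; exact p.nonneg _
  · exact le_of_mul_le_mul_right h h0

theorem star_eq (p : CStarSeminorm R) (x : R) : p.toFun (star x) = p.toFun x :=
  le_antisymm (by simpa using p.le_star (star x)) (p.le_star x)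

/-- The pointwise supremum of a pointwise bounded family of C*-seminorms. -/
def iSup {ι : Sort*} (p : ι → CStarSeminorm R)
    (hp : ∀ x, BddAbove (Set.range fun i => (p i).toFun x)) : CStarSeminorm R where
  toFun x := ⨆ i, (p i).toFun x
  add_le x y := Real.iSup_le
    (fun i => ((p i).add_le x y).trans (add_le_add (le_ciSup (hp x) i) (le_ciSup (hp y) i)))
    (add_nonneg (Real.iSup_nonneg fun i => (p i).nonneg x)
      (Real.iSup_nonneg fun i => (p i).nonneg y))
  smul c x := by
    simp only [(p _).smul]
    rw [Real.mul_iSup_of_nonneg (norm_nonneg c)]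
  mul_le x y := Real.iSup_le
    (fun i => ((p i).mul_le x y).trans (mul_le_mul (le_ciSup (hp x) i) (le_ciSup (hp y) i)
      ((p i).nonneg y) (Real.iSup_nonneg fun i => (p i).nonneg x)))
    (mul_nonneg (Real.iSup_nonneg fun i => (p i).nonneg x)
      (Real.iSup_nonneg fun i => (p i).nonneg y))
  star_mul_self x := by
    have hx : 0 ≤ ⨆ i, (p i).toFun x := Real.iSup_nonneg fun i => (p i).nonneg x
    have hs : 0 ≤ ⨆ i, (p i).toFun (star x * x) := Real.iSup_nonneg fun i => (p i).nonneg _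
    apply le_antisymm
    · refine Real.iSup_le (fun i => ?_) (mul_nonneg hx hx)
      rw [(p i).star_mul_self]
      exact mul_self_le_mul_self ((p i).nonneg x) (le_ciSup (hp x) i)
    · rw [← sq, ← Real.le_sqrt hx hs]
      refine Real.iSup_le (fun i => ?_) (Real.sqrt_nonneg _)
      rw [Real.le_sqrt ((p i).nonneg x) hs, sq, ← (p i).star_mul_self]
      exact le_ciSup (hp (star x * x)) i

/-- The C*-seminorm `x ↦ ‖φ x‖` given by a *-homomorphism `φ` into a C*-algebra. -/
def ofHom {D : Type*} [CStarAlgebra D] (φ : R →⋆ₐ[ℂ] D) : CStarSeminorm R where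
  toFun x := ‖φ x‖
  add_le x y := by rw [map_add]; exact norm_add_le _ _
  smul c x := by rw [map_smul, norm_smul]
  mul_le x y := by rw [map_mul]; exact norm_mul_le _ _
  star_mul_self x := by rw [map_mul, map_star, CStarRing.norm_star_mul_self]

/-- The *-algebra `R`, viewed as a seminormed space via the C*-seminorm `p`. -/
def Pre (_ : CStarSeminorm R) : Type _ := R

instance (p : CStarSeminorm R) : Ring p.Pre := inferInstanceAs (Ring R)
instance (p : CStarSeminorm R) : StarRing p.Pre := inferInstanceAs (StarRing R)
instance (p : CStarSeminorm R) : Algebra ℂ p.Pre := inferInstanceAs (Algebra ℂ R)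
instance (p : CStarSeminorm R) [StarModule ℂ R] : StarModule ℂ p.Pre :=
  inferInstanceAs (StarModule ℂ R)

/-- The identity map from `R` to `p.Pre`. -/
def toPre (p : CStarSeminorm R) : R →⋆ₐ[ℂ] p.Pre := StarAlgHom.id ℂ R

instance (p : CStarSeminorm R) : Norm p.Pre := ⟨p.toFun⟩

instance (p : CStarSeminorm R) : SeminormedAddCommGroup p.Pre :=
  SeminormedAddCommGroup.ofCore (𝕜 := ℂ)
    { norm_nonneg := p.nonneg
      norm_smul := p.smul
      norm_triangle := p.add_le }

instance (p : CStarSeminorm R) : SeminormedRing p.Pre :=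
  { (inferInstance : Ring p.Pre), (inferInstance : SeminormedAddCommGroup p.Pre) with
    norm_mul_le := p.mul_le }

instance (p : CStarSeminorm R) : NormedAlgebra ℂ p.Pre where
  norm_smul_le c x := (p.smul c x).le

instance (p : CStarSeminorm R) : NormedStarGroup p.Pre where
  norm_star_le x := (p.star_eq x).le

/-- The C*-algebra obtained from `R` by dividing out the null space of the C*-seminorm `p` and
completing. -/
abbrev Compl (p : CStarSeminorm R) : Type _ := UniformSpace.Completion p.Pre

/-- The canonical map from `R` to its completion, as a function. -/
def coe (p : CStarSeminorm R) (x : R) : p.Compl := ((p.toPre x : p.Pre) : p.Compl)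

theorem norm_coe (p : CStarSeminorm R) (x : R) : ‖p.coe x‖ = p.toFun x :=
  UniformSpace.Completion.norm_coe (p.toPre x)

theorem coe_add (p : CStarSeminorm R) (x y : R) : p.coe (x + y) = p.coe x + p.coe y :=
  UniformSpace.Completion.coe_add (p.toPre x) (p.toPre y)

theorem coe_mul (p : CStarSeminorm R) (x y : R) : p.coe (x * y) = p.coe x * p.coe y :=
  UniformSpace.Completion.coe_mul (p.toPre x) (p.toPre y)

theorem coe_smul (p : CStarSeminorm R) (c : ℂ) (x : R) : p.coe (c • x) = c • p.coe x :=
  UniformSpace.Completion.coe_smul c (p.toPre x)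

theorem denseRange_coe (p : CStarSeminorm R) : DenseRange p.coe :=
  UniformSpace.Completion.denseRange_coe (α := p.Pre)

instance (p : CStarSeminorm R) : NormedAlgebra ℂ p.Compl where
  norm_smul_le := norm_smul_le

@[elab_as_elim]
theorem ind {p : CStarSeminorm R} {P : p.Compl → Prop} (a : p.Compl)
    (hP : IsClosed {a | P a}) (h : ∀ x, P (p.coe x)) : P a :=
  UniformSpace.Completion.induction_on a hP h

@[elab_as_elim]
theorem ind₂ {p : CStarSeminorm R} {P : p.Compl → p.Compl → Prop} (a b : p.Compl)
    (hP : IsClosed {a : p.Compl × p.Compl | P a.1 a.2}) (h : ∀ x y, P (p.coe x) (p.coe y)) :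
    P a b :=
  UniformSpace.Completion.induction_on₂ a b hP h

/-- The involution of the completion: the continuous extension of the involution of `R`. -/
instance (p : CStarSeminorm R) : Star p.Compl where
  star := UniformSpace.Completion.map (star : p.Pre → p.Pre)

theorem continuous_star (p : CStarSeminorm R) : Continuous (star : p.Compl → p.Compl) :=
  UniformSpace.Completion.continuous_map (f := (star : p.Pre → p.Pre))

theorem star_coe (p : CStarSeminorm R) (x : R) : star (p.coe x) = p.coe (star x) :=
  UniformSpace.Completion.map_coe (f := (star : p.Pre → p.Pre))
    (AddMonoidHomClass.isometry_of_norm (starAddEquiv (R := p.Pre))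
      (fun x => norm_star x)).uniformContinuous (p.toPre x)

instance (p : CStarSeminorm R) : StarRing p.Compl where
  star_involutive a := by
    have := p.continuous_star
    induction a using ind with
    | hP => exact isClosed_eq (by fun_prop) (by fun_prop)
    | h x => rw [star_coe, star_coe, star_star]
  star_mul a b := by
    have := p.continuous_star
    induction a, b using ind₂ with
    | hP => exact isClosed_eq (by fun_prop) (by fun_prop)
    | h x y => rw [← coe_mul, star_coe, star_coe, star_coe, star_mul, coe_mul]
  star_add a b := by
    have := p.continuous_star
    induction a, b using ind₂ with
    | hP => exact isClosed_eq (by fun_prop) (by fun_prop)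
    | h x y => rw [← coe_add, star_coe, star_coe, star_coe, star_add, coe_add]

theorem star_smul_compl [StarModule ℂ R] (p : CStarSeminorm R) (c : ℂ) (a : p.Compl) :
    star (c • a) = star c • star a := by
  induction a using ind with
  | hP =>
    exact isClosed_eq (p.continuous_star.comp (continuous_const_smul c))
      ((continuous_const_smul (star c)).comp p.continuous_star)
  | h x => rw [star_coe, ← coe_smul, star_coe, star_smul, coe_smul]

theorem norm_mul_self_le_compl (p : CStarSeminorm R) (a : p.Compl) :
    ‖a‖ * ‖a‖ ≤ ‖star a * a‖ := by
  have := p.continuous_star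
  induction a using ind with
  | hP => exact isClosed_le (by fun_prop) (by fun_prop)
  | h x => rw [star_coe, ← coe_mul, norm_coe, norm_coe, p.star_mul_self]

instance [StarModule ℂ R] (p : CStarSeminorm R) : CStarAlgebra p.Compl where
  norm_mul_self_le := p.norm_mul_self_le_compl
  star_smul := p.star_smul_compl

/-- The canonical *-homomorphism from `R` to its completion. -/
def toCompl [StarModule ℂ R] (p : CStarSeminorm R) : R →⋆ₐ[ℂ] p.Compl where
  toFun := p.coe
  map_one' := rfl
  map_mul' := p.coe_mul
  map_zero' := rfl
  map_add' := p.coe_add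
  commutes' _ := rfl
  map_star' x := (p.star_coe x).symm

theorem toCompl_eq_of [StarModule ℂ R] (p : CStarSeminorm R) {x y : R}
    (h : p.toFun (x - y) = 0) : p.toCompl x = p.toCompl y := by
  rw [← sub_eq_zero, ← map_sub, ← norm_eq_zero]
  exact (p.norm_coe _).trans h

end CStarSeminorm

/-! ### Free *-algebras and *-polynomials -/

/-- The free unital complex *-algebra on a set `X` of generators: the algebra of the free monoid on
`X ⊕ X`, where `Sum.inl x` is the generator `x` and `Sum.inr x` is its adjoint. -/
def FreeStar (X : Type) : Type := MonoidAlgebra ℂ (FreeMonoid (X ⊕ X))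

namespace FreeStar

variable {X : Type}

instance : Ring (FreeStar X) := inferInstanceAs (Ring (MonoidAlgebra ℂ (FreeMonoid (X ⊕ X))))
instance : Algebra ℂ (FreeStar X) :=
  inferInstanceAs (Algebra ℂ (MonoidAlgebra ℂ (FreeMonoid (X ⊕ X))))

/-- The monomial `c • w`. -/
def mono (w : FreeMonoid (X ⊕ X)) (c : ℂ) : FreeStar X := MonoidAlgebra.single w c

/-- The adjoint of a word: reverse the word and exchange each letter with its adjoint. -/
def adj (w : FreeMonoid (X ⊕ X)) : FreeMonoid (X ⊕ X) := FreeMonoid.map Sum.swap (star w)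

theorem adj_mul (v w : FreeMonoid (X ⊕ X)) : adj (v * w) = adj w * adj v := by
  simp [adj]

theorem adj_adj (w : FreeMonoid (X ⊕ X)) : adj (adj w) = w := by
  induction w using FreeMonoid.inductionOn' with
  | one => simp [adj]
  | of_mul x w ih =>
    rw [adj_mul, adj_mul, ih]
    simp [adj]

/-- The involution, as an additive map: `c • w ↦ conj c • adj w`. -/
def starHom : FreeStar X →+ FreeStar X :=
  MonoidAlgebra.liftNC (k := ℂ) (G := FreeMonoid (X ⊕ X)) (R := FreeStar X)
    ((algebraMap ℂ (FreeStar X)).comp (starRingEnd ℂ)).toAddMonoidHom (fun w => mono (adj w) 1)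

theorem mono_mul (v w : FreeMonoid (X ⊕ X)) (b c : ℂ) :
    mono v b * mono w c = mono (v * w) (b * c) := MonoidAlgebra.single_mul_single ..

theorem smul_mono (w : FreeMonoid (X ⊕ X)) (b c : ℂ) : b • mono w c = mono w (b * c) :=
  MonoidAlgebra.smul_single ..

theorem starHom_mono (w : FreeMonoid (X ⊕ X)) (c : ℂ) :
    starHom (mono w c) = mono (adj w) (star c) := by
  refine (MonoidAlgebra.liftNC_single ..).trans ?_
  change algebraMap ℂ (FreeStar X) (star c) * mono (adj w) 1 = _
  rw [← Algebra.smul_def, smul_mono, mul_one]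

@[elab_as_elim]
theorem ind {P : FreeStar X → Prop} (a : FreeStar X) (hm : ∀ w c, P (mono w c))
    (hadd : ∀ a b, P a → P b → P (a + b)) : P a :=
  MonoidAlgebra.induction_linear (motive := P) a
    (by simpa [mono] using! hm 1 0) hadd hm

instance : StarRing (FreeStar X) where
  star := starHom
  star_involutive a := by
    induction a using ind with
    | hm w c => rw [starHom_mono, starHom_mono, adj_adj, star_star]
    | hadd a b ha hb => rw [map_add, map_add, ha, hb]
  star_mul a b := by
    change starHom (a * b) = starHom b * starHom a
    induction a using ind with
    | hadd a a' ha hb => rw [add_mul, map_add, map_add, ha, hb, mul_add]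
    | hm w c =>
      induction b using ind with
      | hadd b b' ha hb => rw [mul_add, map_add, map_add, ha, hb, add_mul]
      | hm v d =>
        rw [mono_mul, starHom_mono, starHom_mono, starHom_mono, mono_mul, adj_mul, star_mul]
  star_add := map_add starHom

theorem star_mono (w : FreeMonoid (X ⊕ X)) (c : ℂ) : star (mono w c) = mono (adj w) (star c) :=
  starHom_mono w c

instance : StarModule ℂ (FreeStar X) where
  star_smul c a := by
    induction a using ind with
    | hm w d => rw [smul_mono, star_mono, star_mono, smul_mono, star_mul, mul_comm]
    | hadd a b ha hb => rw [smul_add, star_add, star_add, ha, hb, smul_add]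

/-- The generator `x`. -/
def gen (x : X) : FreeStar X := mono (FreeMonoid.of (Sum.inl x)) 1

variable {D : Type*} [Ring D] [StarRing D]

/-- The value of a word at a family `f` of elements of `D`. -/
def evalWord (f : X → D) : FreeMonoid (X ⊕ X) →* D :=
  FreeMonoid.lift (Sum.elim f fun x => star (f x))

theorem evalWord_adj (f : X → D) (w : FreeMonoid (X ⊕ X)) :
    evalWord f (adj w) = star (evalWord f w) := by
  induction w using FreeMonoid.inductionOn' with
  | one => simp [adj]
  | of_mul x w ih =>
    rw [adj_mul, map_mul, map_mul, star_mul, ih]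
    congr 1
    rcases x with x | x <;> simp [adj, evalWord]

variable [Algebra ℂ D]

/-- The evaluation of *-polynomials at `f`, as a homomorphism of algebras. -/
def evalHom (f : X → D) : FreeStar X →ₐ[ℂ] D :=
  MonoidAlgebra.lift ℂ D (FreeMonoid (X ⊕ X)) (evalWord f)

theorem evalHom_mono (f : X → D) (w : FreeMonoid (X ⊕ X)) (c : ℂ) :
    evalHom f (mono w c) = c • evalWord f w :=
  MonoidAlgebra.lift_single ..

variable [StarModule ℂ D]

/-- The evaluation of *-polynomials at a family `f` of elements: the *-homomorphism that maps
the generator `x` to `f x`. -/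
def eval (f : X → D) : FreeStar X →⋆ₐ[ℂ] D where
  __ := evalHom f
  map_star' a := by
    change evalHom f (star a) = star (evalHom f a)
    induction a using ind with
    | hm w c => rw [star_mono, evalHom_mono, evalHom_mono, evalWord_adj, star_smul]
    | hadd a b ha hb => rw [star_add, map_add, ha, hb, map_add, star_add]

theorem eval_mono (f : X → D) (w : FreeMonoid (X ⊕ X)) (c : ℂ) :
    eval f (mono w c) = c • evalWord f w :=
  evalHom_mono f w c

theorem eval_gen (f : X → D) (x : X) : eval f (gen x) = f x := by
  rw [gen, eval_mono, one_smul, evalWord, FreeMonoid.lift_eval_of, Sum.elim_inl]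

/-- If the generators are uniformly bounded along a family of evaluations, then so is every
*-polynomial. -/
theorem bddAbove_eval {ι : Sort*} {D : ι → Type*} [∀ i, CStarAlgebra (D i)] (f : ∀ i, X → D i)
    (hf : ∀ x, ∃ C, ∀ i, ‖f i x‖ ≤ C) (a : FreeStar X) :
    BddAbove (Set.range fun i => ‖eval (f i) a‖) := by
  suffices h : ∃ C, ∀ i, ‖eval (f i) a‖ ≤ C by
    obtain ⟨C, hC⟩ := h
    exact ⟨C, by rintro _ ⟨i, rfl⟩; exact hC i⟩
  induction a using ind with
  | hadd a b ha hb =>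
    obtain ⟨C, hC⟩ := ha
    obtain ⟨C', hC'⟩ := hb
    refine ⟨C + C', fun i => ?_⟩
    rw [map_add]
    exact (norm_add_le _ _).trans (add_le_add (hC i) (hC' i))
  | hm w c =>
    suffices h : ∃ C, ∀ i, ‖evalWord (f i) w‖ ≤ C by
      obtain ⟨C, hC⟩ := h
      refine ⟨‖c‖ * C, fun i => ?_⟩
      rw [eval_mono, norm_smul]
      exact mul_le_mul_of_nonneg_left (hC i) (norm_nonneg c)
    induction w using FreeMonoid.inductionOn' with
    | one =>
      refine ⟨1, fun i => ?_⟩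
      rw [map_one]
      rcases subsingleton_or_nontrivial (D i) with _ | _
      · simp [Subsingleton.elim (1 : D i) 0]
      · exact CStarRing.norm_one.le
    | of_mul x w ih =>
      obtain ⟨C, hC⟩ := ih
      obtain ⟨B, hB⟩ : ∃ B, ∀ i, ‖evalWord (f i) (FreeMonoid.of x)‖ ≤ B := by
        rcases x with x | x <;> obtain ⟨B, hB⟩ := hf x <;>
          exact ⟨B, fun i => by simpa [evalWord] using hB i⟩
      refine ⟨B * C, fun i => ?_⟩
      rw [map_mul]
      exact (norm_mul_le _ _).trans (mul_le_mul (hB i) (hC i) (norm_nonneg _)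
        ((norm_nonneg _).trans (hB i)))

end FreeStar

/-! ### Universal C*-algebras -/

/-- A realisation of the relations `rel` on generators `X`: a unital C*-algebra together with a
family of elements that satisfies the relations. A C*-algebra generated by a family indexed by a
type in `Type` is isomorphic to one in `Type`, so this universe sees all realisations. -/
structure Realisation (X : Type) (rel : ∀ (D : Type) [CStarAlgebra D], (X → D) → Prop) where
  D : Type
  [cstar : CStarAlgebra D]
  f : X → D
  holds : rel D f

attribute [instance] Realisation.cstar

section Universal

variable {X : Type} (rel : ∀ (D : Type) [CStarAlgebra D], (X → D) → Prop)
  (hrel : ∀ x, ∃ C : ℝ, ∀ r : Realisation X rel, ‖r.f x‖ ≤ C)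

/-- The largest C*-seminorm on the free *-algebra under which the relations hold: the supremum of
`‖P(f)‖` over all realisations `f` of the relations. -/
def univSeminorm : CStarSeminorm (FreeStar X) :=
  CStarSeminorm.iSup (fun r : Realisation X rel => CStarSeminorm.ofHom (FreeStar.eval r.f))
    (FreeStar.bddAbove_eval (fun r : Realisation X rel => r.f) hrel)

/-- The universal unital C*-algebra `C*(X | rel)`, for relations that bound the norms of the
generators. -/
abbrev UnivCStar : Type := (univSeminorm rel hrel).Compl

/-- The generators of `C*(X | rel)`. -/
def univGen (x : X) : UnivCStar rel hrel := (univSeminorm rel hrel).toCompl (FreeStar.gen x)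

theorem univGen_eq_of {a b : FreeStar X}
    (h : ∀ r : Realisation X rel, FreeStar.eval r.f a = FreeStar.eval r.f b) :
    (univSeminorm rel hrel).toCompl a = (univSeminorm rel hrel).toCompl b := by
  refine CStarSeminorm.toCompl_eq_of _ (le_antisymm (Real.iSup_le (fun r => ?_) le_rfl)
    (CStarSeminorm.nonneg _ _))
  change ‖FreeStar.eval r.f (a - b)‖ ≤ 0
  rw [map_sub, h r, sub_self, norm_zero]

theorem univGen_isStarProjection {x : X} (h : ∀ r : Realisation X rel, IsStarProjection (r.f x)) :
    IsStarProjection (univGen rel hrel x) := by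
  constructor
  · change _ * _ = _
    rw [univGen, ← map_mul]
    refine univGen_eq_of rel hrel fun r => ?_
    rw [map_mul, FreeStar.eval_gen]
    exact (h r).isIdempotentElem
  · change star _ = _
    rw [univGen, ← map_star]
    refine univGen_eq_of rel hrel fun r => ?_
    rw [map_star, FreeStar.eval_gen]
    exact (h r).isSelfAdjoint

end Universal

/-! ### The minimal tensor product -/

section Operators

variable {E : Type*} [NormedAddCommGroup E] [InnerProductSpace ℂ E]

theorem opNorm_smul_eq (c : ℂ) (T : E →L[ℂ] E) : ‖c • T‖ = ‖c‖ * ‖T‖ := norm_smul c T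

theorem opNorm_adj_le (T S : E →L[ℂ] E) (h : ∀ v w, inner ℂ (T v) w = inner ℂ v (S w)) :
    ‖S‖ ≤ ‖T‖ := by
  refine S.opNorm_le_bound (norm_nonneg _) fun w => ?_
  have h1 : ‖S w‖ * ‖S w‖ ≤ ‖T‖ * ‖w‖ * ‖S w‖ := by
    rw [← inner_self_eq_norm_mul_norm (𝕜 := ℂ), ← h]
    refine (RCLike.re_le_norm _).trans ((norm_inner_le_norm _ _).trans ?_)
    have := T.le_opNorm (S w)
    have := mul_le_mul_of_nonneg_right this (norm_nonneg w)
    linarith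
  rcases (norm_nonneg (S w)).eq_or_lt with h0 | h0
  · rw [← h0]; positivity
  · exact le_of_mul_le_mul_right h1 h0

/-- The C*-identity for adjointable bounded operators on an inner product space. -/
theorem opNorm_adj_mul_self (T S : E →L[ℂ] E) (h : ∀ v w, inner ℂ (T v) w = inner ℂ v (S w)) :
    ‖S * T‖ = ‖T‖ * ‖T‖ := by
  apply le_antisymm
  · exact (norm_mul_le _ _).trans
      (mul_le_mul_of_nonneg_right (opNorm_adj_le T S h) (norm_nonneg _))
  · have hle : ‖T‖ ≤ Real.sqrt ‖S * T‖ := by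
      refine T.opNorm_le_bound (Real.sqrt_nonneg _) fun v => ?_
      rw [← Real.sqrt_sq (norm_nonneg v), ← Real.sqrt_mul (norm_nonneg _)]
      refine Real.le_sqrt_of_sq_le ?_
      rw [sq, ← inner_self_eq_norm_mul_norm (𝕜 := ℂ), h]
      refine (RCLike.re_le_norm _).trans ((norm_inner_le_norm _ _).trans ?_)
      have := (S * T).le_opNorm v
      have := mul_le_mul_of_nonneg_left this (norm_nonneg v)
      calc ‖v‖ * ‖S (T v)‖ ≤ ‖v‖ * (‖S * T‖ * ‖v‖) := this
        _ = _ := by ring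
    calc ‖T‖ * ‖T‖ ≤ Real.sqrt ‖S * T‖ * Real.sqrt ‖S * T‖ :=
          mul_self_le_mul_self (norm_nonneg _) hle
      _ = _ := Real.mul_self_sqrt (norm_nonneg _)

end Operators

/-- A pair of unital *-representations of `A` and of `B` on Hilbert spaces. The universe `Type` of
`A` and `B` is large enough for the Hilbert spaces, since it contains those of the cyclic
representations given by the states of `A` and `B`. -/
structure RepPair (A B : Type) [CStarAlgebra A] [CStarAlgebra B] where
  H : Type
  K : Type
  [normH : NormedAddCommGroup H]
  [innerH : InnerProductSpace ℂ H]
  [completeH : CompleteSpace H]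
  [normK : NormedAddCommGroup K]
  [innerK : InnerProductSpace ℂ K]
  [completeK : CompleteSpace K]
  ξ : A →⋆ₐ[ℂ] (H →L[ℂ] H)
  η : B →⋆ₐ[ℂ] (K →L[ℂ] K)

attribute [instance] RepPair.normH RepPair.innerH RepPair.completeH RepPair.normK RepPair.innerK
  RepPair.completeK

namespace RepPair

variable {A B : Type} [CStarAlgebra A] [CStarAlgebra B]

/-- The product representation `ξ ⊗ η` of the algebraic tensor product `A ⊙ B` by bounded operators
on the algebraic tensor product `H ⊙ K` with the inner product
`⟪h ⊗ k, h' ⊗ k'⟫ = ⟪h, h'⟫ ⟪k, k'⟫`. The Hilbert space `H ⊗ K` is the completion of `H ⊙ K`, so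
the operator norm on `H ⊙ K` is the operator norm of the extension to `H ⊗ K`. -/
def rep (r : RepPair A B) : A ⊗[ℂ] B →ₐ[ℂ] (r.H ⊗[ℂ] r.K →L[ℂ] r.H ⊗[ℂ] r.K) :=
  Algebra.TensorProduct.lift
    { toFun := fun a => (r.ξ a).rTensor r.K
      map_one' := by simp
      map_mul' := fun a b => by rw [map_mul, ContinuousLinearMap.rTensor_mul]
      map_zero' := by simp
      map_add' := fun a b => by rw [map_add, ContinuousLinearMap.rTensor_add]
      commutes' := fun c => by simp [Algebra.algebraMap_eq_smul_one] }
    { toFun := fun b => (r.η b).lTensor r.H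
      map_one' := by simp
      map_mul' := fun a b => by rw [map_mul, ContinuousLinearMap.lTensor_mul]
      map_zero' := by simp
      map_add' := fun a b => by rw [map_add, ContinuousLinearMap.lTensor_add]
      commutes' := fun c => by simp [Algebra.algebraMap_eq_smul_one] }
    (fun a b => by
      refine ContinuousLinearMap.ext fun v => ?_
      change (r.ξ a).rTensor r.K ((r.η b).lTensor r.H v) =
        (r.η b).lTensor r.H ((r.ξ a).rTensor r.K v)
      induction v using TensorProduct.induction_on with
      | zero => simp only [map_zero]
      | tmul h k => rfl
      | add v w hv hw => simp only [map_add, hv, hw])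

theorem rep_tmul (r : RepPair A B) (a : A) (b : B) :
    r.rep (a ⊗ₜ b) = TensorProduct.mapL (r.ξ a) (r.η b) :=
  Algebra.TensorProduct.lift_tmul ..

theorem inner_rep (r : RepPair A B) (x : A ⊗[ℂ] B) (v w : r.H ⊗[ℂ] r.K) :
    inner ℂ (r.rep x v) w = inner ℂ v (r.rep (star x) w) := by
  induction x using TensorProduct.induction_on with
  | zero => simp
  | add x y hx hy =>
    simp only [map_add, star_add, add_apply, inner_add_left, inner_add_right,
      hx, hy]
  | tmul a b =>
    rw [TensorProduct.star_tmul, rep_tmul, rep_tmul]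
    induction v using TensorProduct.induction_on with
    | zero => simp
    | add v v' hv hv' => simp only [map_add, inner_add_left, hv, hv']
    | tmul h k =>
      induction w using TensorProduct.induction_on with
      | zero => simp
      | add w w' hw hw' => simp only [map_add, inner_add_right, hw, hw']
      | tmul h' k' =>
        rw [TensorProduct.mapL_tmul, TensorProduct.mapL_tmul, TensorProduct.inner_tmul,
          TensorProduct.inner_tmul, map_star, map_star, ContinuousLinearMap.star_eq_adjoint,
          ContinuousLinearMap.star_eq_adjoint, ContinuousLinearMap.adjoint_inner_right,
          ContinuousLinearMap.adjoint_inner_right]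

/-- The C*-seminorm `x ↦ ‖(ξ ⊗ η)(x)‖` on the algebraic tensor product. -/
def seminorm (r : RepPair A B) : CStarSeminorm (A ⊗[ℂ] B) where
  toFun x := ‖r.rep x‖
  add_le x y := by rw [map_add]; exact ContinuousLinearMap.opNorm_add_le _ _
  smul c x := by rw [map_smul]; exact opNorm_smul_eq _ _
  mul_le x y := by rw [map_mul]; exact ContinuousLinearMap.opNorm_comp_le _ _
  star_mul_self x := by
    rw [map_mul]
    exact opNorm_adj_mul_self _ _ (r.inner_rep x)

theorem bddAbove (x : A ⊗[ℂ] B) :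
    BddAbove (Set.range fun r : RepPair A B => r.seminorm.toFun x) := by
  suffices h : ∃ C, ∀ r : RepPair A B, r.seminorm.toFun x ≤ C by
    obtain ⟨C, hC⟩ := h
    exact ⟨C, by rintro _ ⟨r, rfl⟩; exact hC r⟩
  induction x using TensorProduct.induction_on with
  | zero => exact ⟨0, fun r => r.seminorm.zero'.le⟩
  | add x y hx hy =>
    obtain ⟨C, hC⟩ := hx
    obtain ⟨C', hC'⟩ := hy
    exact ⟨C + C', fun r => (r.seminorm.add_le x y).trans (add_le_add (hC r) (hC' r))⟩
  | tmul a b =>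
    refine ⟨‖a‖ * ‖b‖, fun r => ?_⟩
    change ‖r.rep (a ⊗ₜ b)‖ ≤ _
    rw [rep_tmul]
    exact (TensorProduct.norm_mapL_le _ _).trans (mul_le_mul
      (NonUnitalStarAlgHom.norm_apply_le r.ξ a) (NonUnitalStarAlgHom.norm_apply_le r.η b)
      (norm_nonneg _) (norm_nonneg _))

end RepPair

/-- The minimal C*-norm on `A ⊙ B`: the supremum of `‖(ξ ⊗ η)(x)‖` over all representations `ξ` of
`A` and `η` of `B`. -/
def minNorm (A B : Type) [CStarAlgebra A] [CStarAlgebra B] : CStarSeminorm (A ⊗[ℂ] B) :=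
  CStarSeminorm.iSup (fun r : RepPair A B => r.seminorm) RepPair.bddAbove

/-- The minimal tensor product of two unital C*-algebras. -/
abbrev MinTensor (A B : Type) [CStarAlgebra A] [CStarAlgebra B] : Type := (minNorm A B).Compl

/-- The elementary tensor `a ⊗ b` in the minimal tensor product. -/
def tmul {A B : Type} [CStarAlgebra A] [CStarAlgebra B] (a : A) (b : B) : MinTensor A B :=
  (minNorm A B).toCompl (a ⊗ₜ b)

section tmul

variable {A B : Type} [CStarAlgebra A] [CStarAlgebra B]

theorem tmul_mul_tmul (a a' : A) (b b' : B) :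
    tmul a b * tmul a' b' = tmul (a * a') (b * b') := by
  rw [tmul, tmul, ← map_mul, Algebra.TensorProduct.tmul_mul_tmul, tmul]

theorem star_tmul (a : A) (b : B) : star (tmul a b) = tmul (star a) (star b) := by
  rw [tmul, ← map_star, TensorProduct.star_tmul, tmul]

theorem one_tmul_one : tmul (1 : A) (1 : B) = 1 := by
  rw [tmul, ← Algebra.TensorProduct.one_def, map_one]

theorem zero_tmul (b : B) : tmul (0 : A) b = 0 := by
  rw [tmul, TensorProduct.zero_tmul, map_zero]

theorem sum_tmul {ι : Type*} (t : Finset ι) (f : ι → A) (b : B) :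
    ∑ i ∈ t, tmul (f i) b = tmul (∑ i ∈ t, f i) b := by
  simp only [tmul, ← map_sum, TensorProduct.sum_tmul]

theorem tmul_sum {ι : Type*} (t : Finset ι) (a : A) (f : ι → B) :
    ∑ i ∈ t, tmul a (f i) = tmul a (∑ i ∈ t, f i) := by
  simp only [tmul, ← map_sum, TensorProduct.tmul_sum]

end tmul

/-! ### Matrices over C*-algebras and magic unitaries -/

/-- A matrix over a unital *-algebra is a magic unitary if its entries are projections that sum up
to `1` in every row and in every column. -/
structure IsMagic {N : ℕ} {D : Type*} [Ring D] [StarRing D] (u : Matrix (Fin N) (Fin N) D) :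
    Prop where
  proj : ∀ i j, IsStarProjection (u i j)
  row : ∀ i, ∑ j, u i j = 1
  col : ∀ j, ∑ i, u i j = 1

/-- A pair `(D, M)` of a unital C*-algebra `D` and an `N × N`-matrix `M` over `D`. -/
structure MatPair (N : ℕ) where
  D : Type
  [cstar : CStarAlgebra D]
  M : Matrix (Fin N) (Fin N) D

attribute [instance] MatPair.cstar

namespace MatPair

variable {N : ℕ}

/-- The unital C*-subalgebra of `D` generated by the entries of `M`. For magic unitaries of size
`N ≥ 1` the unit is a sum of entries, so this is also the C*-subalgebra generated by the entries
without the unit adjoined. -/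
def entryAlg (P : MatPair N) : StarSubalgebra ℂ P.D :=
  (StarAlgebra.adjoin ℂ (Set.range fun ij : Fin N × Fin N => P.M ij.1 ij.2)).topologicalClosure

theorem mem_entryAlg (P : MatPair N) (i j : Fin N) : P.M i j ∈ P.entryAlg :=
  StarSubalgebra.le_topologicalClosure _
    (StarAlgebra.subset_adjoin ℂ _ (Set.mem_range_self (i, j)))

instance (P : MatPair N) : IsClosed (P.entryAlg : Set P.D) :=
  StarSubalgebra.isClosed_topologicalClosure _

/-- The pair `(C*(m_ij), M)`: the C*-algebra is cut down to the one generated by the entries. -/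
def cut (P : MatPair N) : MatPair N where
  D := P.entryAlg
  M := Matrix.of fun i j => ⟨P.M i j, P.mem_entryAlg i j⟩

/-- The product of `(A, M)` and `(B, M')`: the matrix with the entries `∑ k, m_ik ⊗ m'_kj` over
the minimal tensor product of `A` and `B`. -/
def oprod (P Q : MatPair N) : MatPair N where
  D := MinTensor P.D Q.D
  M := Matrix.of fun i j => ∑ k, tmul (P.M i k) (Q.M k j)

/-- The product `P₁ ⊥ P₂ ⊥ ⋯ ⊥ Pᵣ` of a list of pairs; by convention, the identity matrix over `ℂ`
for the empty list. -/
def listProd : List (MatPair N) → MatPair N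
  | [] => ⟨ℂ, 1⟩
  | P :: Ps => Ps.foldl oprod P

/-- The `n`-fold product `P ⊥ ⋯ ⊥ P`. -/
def pow (P : MatPair N) (n : ℕ) : MatPair N := listProd (List.replicate n P)

/-- An arrow from `(D₁, M₁)` to `(D₂, M₂)`: a *-homomorphism that maps the entries of `M₁` to the
corresponding entries of `M₂`. -/
structure Arrow (P Q : MatPair N) where
  hom : P.D →⋆ₐ[ℂ] Q.D
  map_entry : ∀ i j, hom (P.M i j) = Q.M i j

/-- `(D, M)` is a compact matrix quantum group: `D` is generated by the entries of `M`, the matrices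
`M = (m_ij)` and `(m_ij^*)` are unitary and invertible, respectively, and there is a
comultiplication `Δ : D → D ⊗ D` with `Δ(m_ij) = ∑ k, m_ik ⊗ m_kj`. -/
structure IsCMQG (P : MatPair N) : Prop where
  generated : P.entryAlg = ⊤
  unitary : P.M ∈ unitary (Matrix (Fin N) (Fin N) P.D)
  invertible : IsUnit (P.M.map star)
  comul : ∃ Δ : P.D →⋆ₐ[ℂ] MinTensor P.D P.D, ∀ i j, Δ (P.M i j) = ∑ k, tmul (P.M i k) (P.M k j)

/-- The inverse limit of an inverse system `P₀ ← P₁ ← P₂ ← ⋯` of pairs whose matrices have bounded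
entries: the Hausdorff completion of the free *-algebra on `N²` symbols `m_ij` with respect to the
C*-seminorm `f ↦ sup_n ‖f(Mₙ)‖`, with the matrix `(m_ij)`. The connecting arrows of an inverse
system are determined by the pairs, since the algebras are generated by the entries of the
matrices; they do not enter the construction. -/
def invLimit (P : ℕ → MatPair N) (hP : ∀ i j, ∃ C : ℝ, ∀ n, ‖(P n).M i j‖ ≤ C) : MatPair N where
  D := (CStarSeminorm.iSup
    (fun n => CStarSeminorm.ofHom
      (FreeStar.eval fun ij : Fin N × Fin N => (P n).M ij.1 ij.2))
    (FreeStar.bddAbove_eval (fun n (ij : Fin N × Fin N) => (P n).M ij.1 ij.2)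
      fun ij => hP ij.1 ij.2)).Compl
  M := Matrix.of fun i j => CStarSeminorm.toCompl _ (FreeStar.gen (i, j))

end MatPair

theorem IsMagic.norm_le_one {N : ℕ} {D : Type*} [CStarAlgebra D] {u : Matrix (Fin N) (Fin N) D}
    (hu : IsMagic u) (i j : Fin N) : ‖u i j‖ ≤ 1 :=
  (hu.proj i j).norm_le

/-- The entries in a row of a magic unitary over a C*-algebra are mutually orthogonal. -/
theorem IsMagic.mul_eq_zero {N : ℕ} {D : Type*} [CStarAlgebra D] {u : Matrix (Fin N) (Fin N) D}
    (hu : IsMagic u) (i : Fin N) {k l : Fin N} (hkl : k ≠ l) : u i k * u i l = 0 := by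
  let _ := CStarAlgebra.spectralOrder D
  have := CStarAlgebra.spectralOrderedRing D
  have hle : u i k ≤ 1 - u i l := by
    have h1 := hu.row i
    rw [← Finset.add_sum_erase _ _ (Finset.mem_univ l),
      ← Finset.add_sum_erase _ _ (Finset.mem_erase.2 ⟨hkl, Finset.mem_univ k⟩)] at h1
    rw [← h1, add_sub_cancel_left]
    exact le_add_of_nonneg_right (Finset.sum_nonneg fun j _ => (hu.proj i j).nonneg)
  have := (IsStarProjection.le_iff_mul_eq_left (hu.proj i k) (hu.proj i l).one_sub).1 hle
  rw [mul_sub, mul_one, sub_eq_self] at this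
  exact this

/-! ### The quantum permutation group and the permutation group -/

/-- `C(S_N^+)`, the universal C*-algebra generated by the entries of an `N × N` magic unitary,
together with its generating matrix. -/
def SNplus (N : ℕ) : MatPair N where
  D := UnivCStar (X := Fin N × Fin N) (fun _ _ u => IsMagic (Matrix.of fun i j => u (i, j)))
    fun ij => ⟨1, fun r => r.holds.norm_le_one ij.1 ij.2⟩
  M := Matrix.of fun i j => univGen _ _ (i, j)

/-- `C(S_N)` with its generating matrix, the functions `u_ij(σ) = δ_{i,σ(j)}` that read off the
entries of a permutation matrix. -/
def SN (N : ℕ) : MatPair N where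
  D := Equiv.Perm (Fin N) → ℂ
  M := Matrix.of fun i j σ => if i = σ j then 1 else 0

/-! ### The pairs `(B₁, M₁)`, `(Bₙ, Mₙ)` and `(B_∞, M_∞)` -/

/-- The universal unital C*-algebra `A` generated by two projections. -/
abbrev TwoProj : Type :=
  UnivCStar (X := Fin 2) (fun _ _ f => ∀ x, IsStarProjection (f x))
    fun x => ⟨1, fun r => (r.holds x).norm_le⟩

/-- The first generating projection of `A`. -/
def projP : TwoProj := univGen _ _ 0

/-- The second generating projection of `A`. -/
def projQ : TwoProj := univGen _ _ 1

/-- The matrix `R_{(a,b),(c,d)}` with entries `p`, `q`, `1 - p`, `1 - q`, `1` and `0`. -/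
def matR {N : ℕ} {D : Type*} [Ring D] (p q : D) (a b c d : Fin N) : Matrix (Fin N) (Fin N) D :=
  Matrix.of fun i j =>
    if i = j then
      if i = a ∨ i = b then p else if i = c ∨ i = d then q else 1
    else if i = a ∧ j = b ∨ i = b ∧ j = a then 1 - p
    else if i = c ∧ j = d ∨ i = d ∧ j = c then 1 - q
    else 0

/-- The pair `(A, R_{(a,b),(c,d)})`. -/
def pairR {N : ℕ} (a b c d : Fin N) : MatPair N := ⟨TwoProj, matR projP projQ a b c d⟩

theorem isStarProjection_projP : IsStarProjection projP :=
  univGen_isStarProjection _ _ fun r => r.holds 0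

theorem isStarProjection_projQ : IsStarProjection projQ :=
  univGen_isStarProjection _ _ fun r => r.holds 1

section matR

variable {N : ℕ} {D : Type*} [Ring D] (p q : D) {a b c d : Fin N}

theorem matR_symm (a b c d i j : Fin N) : matR p q a b c d i j = matR p q a b c d j i := by
  simp only [matR, Matrix.of_apply]
  by_cases h : i = j
  · subst h; rfl
  · rw [if_neg h, if_neg (Ne.symm h)]
    congr 1
    · exact propext ⟨fun h => by tauto, fun h => by tauto⟩
    · congr 1
      exact propext ⟨fun h => by tauto, fun h => by tauto⟩

theorem matR_row (h : [a, b, c, d].Nodup) (i : Fin N) : ∑ j, matR p q a b c d i j = 1 := by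
  suffices H : ∃ (k : Fin N) (e : D), ∀ j, matR p q a b c d i j =
      (if j = i then e else 0) + (if j = k then 1 - e else 0) by
    obtain ⟨k, e, H⟩ := H
    rw [Finset.sum_congr rfl fun j _ => H j, Finset.sum_add_distrib]
    simp
  simp only [List.nodup_cons, List.mem_cons, List.not_mem_nil, or_false, not_or] at h
  obtain ⟨⟨hab, hac, had⟩, ⟨hbc, hbd⟩, hcd, -⟩ := h
  simp only [matR, Matrix.of_apply]
  by_cases hia : i = a
  · exact ⟨b, p, fun j => by grind⟩
  by_cases hib : i = b
  · exact ⟨a, p, fun j => by grind⟩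
  by_cases hic : i = c
  · exact ⟨d, q, fun j => by grind⟩
  by_cases hid : i = d
  · exact ⟨c, q, fun j => by grind⟩
  · exact ⟨i, 1, fun j => by grind⟩

theorem matR_magic [StarRing D] {p q : D} (hp : IsStarProjection p) (hq : IsStarProjection q)
    (h : [a, b, c, d].Nodup) : IsMagic (matR p q a b c d) where
  proj i j := by
    simp only [matR, Matrix.of_apply]
    split_ifs
    exacts [hp, hq, IsStarProjection.one _, hp.one_sub, hq.one_sub, IsStarProjection.zero _]
  row := matR_row p q h
  col j := by
    simp only [matR_symm p q a b c d _ j]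
    exact matR_row p q h j

end matR

namespace MatPair

variable {N : ℕ}

theorem cut_magic {P : MatPair N} (h : IsMagic P.M) : IsMagic P.cut.M where
  proj i j := ⟨Subtype.ext (h.proj i j).isIdempotentElem, Subtype.ext (h.proj i j).isSelfAdjoint⟩
  row i := Subtype.ext ((AddSubmonoidClass.coe_finsetSum _ _).trans (h.row i))
  col j := Subtype.ext ((AddSubmonoidClass.coe_finsetSum _ _).trans (h.col j))

theorem oprod_magic {P Q : MatPair N} (hP : IsMagic P.M) (hQ : IsMagic Q.M) :
    IsMagic (P.oprod Q).M where
  proj i j := by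
    constructor
    · change (∑ k, tmul (P.M i k) (Q.M k j)) * (∑ k, tmul (P.M i k) (Q.M k j)) =
        ∑ k, tmul (P.M i k) (Q.M k j)
      rw [Finset.sum_mul_sum]
      refine Finset.sum_congr rfl fun k _ => ?_
      rw [Finset.sum_eq_single k]
      · rw [tmul_mul_tmul, (hP.proj i k).isIdempotentElem, (hQ.proj k j).isIdempotentElem]
      · intro l _ hl
        rw [tmul_mul_tmul, hP.mul_eq_zero i hl.symm, zero_tmul]
      · simp
    · change star (∑ k, tmul (P.M i k) (Q.M k j)) = ∑ k, tmul (P.M i k) (Q.M k j)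
      rw [star_sum]
      refine Finset.sum_congr rfl fun k _ => ?_
      rw [star_tmul, (hP.proj i k).isSelfAdjoint, (hQ.proj k j).isSelfAdjoint]
  row i := by
    change ∑ j, ∑ k, tmul (P.M i k) (Q.M k j) = 1
    rw [Finset.sum_comm]
    simp only [tmul_sum, hQ.row, sum_tmul, hP.row, one_tmul_one]
  col j := by
    change ∑ i, ∑ k, tmul (P.M i k) (Q.M k j) = 1
    rw [Finset.sum_comm]
    simp only [sum_tmul, hP.col, tmul_sum, hQ.col, one_tmul_one]

theorem foldl_magic (l : List (MatPair N)) (P : MatPair N) (hP : IsMagic P.M)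
    (h : ∀ Q ∈ l, IsMagic Q.M) : IsMagic (l.foldl oprod P).M := by
  induction l generalizing P with
  | nil => exact hP
  | cons Q l ih =>
    exact ih _ (oprod_magic hP (h Q List.mem_cons_self)) fun Q' hQ' =>
      h Q' (List.mem_cons_of_mem _ hQ')

theorem listProd_magic {l : List (MatPair N)} (h : ∀ P ∈ l, IsMagic P.M) :
    IsMagic (listProd l).M := by
  cases l with
  | nil =>
    refine ⟨fun i j => ?_, fun i => ?_, fun j => ?_⟩
    · change IsStarProjection ((1 : Matrix (Fin N) (Fin N) ℂ) i j)
      rw [Matrix.one_apply]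
      split_ifs
      exacts [IsStarProjection.one _, IsStarProjection.zero _]
    · change ∑ j, (1 : Matrix (Fin N) (Fin N) ℂ) i j = 1
      simp [Matrix.one_apply]
    · change ∑ i, (1 : Matrix (Fin N) (Fin N) ℂ) i j = 1
      simp [Matrix.one_apply]
  | cons P l =>
    exact foldl_magic l P (h P List.mem_cons_self) fun Q hQ => h Q (List.mem_cons_of_mem _ hQ)

theorem pow_magic {P : MatPair N} (h : IsMagic P.M) (n : ℕ) : IsMagic (P.pow n).M :=
  listProd_magic fun Q hQ => by rwa [List.eq_of_mem_replicate hQ]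

end MatPair

/-- The choices in the construction of `M₁`. -/
structure StartData (N : ℕ) where
  /-- A number `L` such that every permutation is a product of at most `L` transpositions. -/
  L : ℕ
  prod_of_swaps : ∀ σ : Equiv.Perm (Fin N), ∃ l : List (Equiv.Perm (Fin N)),
    l.length ≤ L ∧ (∀ τ ∈ l, τ.IsSwap) ∧ l.prod = σ
  /-- The order of the factors: an enumeration of the pairs `(a, b)` with `a < b`. -/
  pairs : List (Fin N × Fin N)
  nodup_pairs : pairs.Nodup
  mem_pairs : ∀ ab, ab ∈ pairs ↔ ab.1 < ab.2
  /-- The indices `c` and `d` that are chosen for each pair `(a, b)`. -/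
  c : Fin N × Fin N → Fin N
  d : Fin N × Fin N → Fin N
  distinct : ∀ a b, a < b → [a, b, c (a, b), d (a, b)].Nodup

namespace StartData

open MatPair

variable {N : ℕ} (s : StartData N)

/-- The matrix `R_{(a,b),*}`. -/
def R (ab : Fin N × Fin N) : MatPair N := pairR ab.1 ab.2 (s.c ab) (s.d ab)

/-- The pair `(B₁, M₁)`: the matrix `M₁` is the `L`-th power of the product of all `R_{(a,b),*}`
with `a < b`, and `B₁` is the C*-algebra generated by its entries. -/
def B₁ : MatPair N := ((listProd (s.pairs.map s.R)).pow s.L).cut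

/-- The pair `(Bₙ, Mₙ)` for `n ≥ 1`: the matrix `Mₙ` is the `n`-th power of `M₁`, and `Bₙ` is the
C*-algebra generated by its entries. -/
def B (n : ℕ) : MatPair N := (s.B₁.pow n).cut

theorem B₁_magic : IsMagic s.B₁.M :=
  cut_magic (pow_magic (listProd_magic (by
    intro P hP
    obtain ⟨ab, hab, rfl⟩ := List.mem_map.1 hP
    exact matR_magic isStarProjection_projP isStarProjection_projQ (s.distinct ab.1 ab.2 ((s.mem_pairs ab).1 hab)))) _)

theorem B_magic (n : ℕ) : IsMagic (s.B n).M := cut_magic (pow_magic s.B₁_magic n)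

/-- The inverse limit `(B_∞, M_∞)` of `(B₁, M₁) ← (B₂, M₂) ← ⋯`. -/
def Binf : MatPair N :=
  invLimit (fun n => s.B (n + 1)) fun i j => ⟨1, fun n => (s.B_magic (n + 1)).norm_le_one i j⟩

end StartData

end QPerm

end

/-!
Say that `(D, M)` is dominated by `(D', M')` if `‖P(M)‖ ≤ ‖P(M')‖` for every `*`-polynomial `P`.
The minimal tensor norm can be computed from any separating families of representations of the
two factors, so domination is monotone under `⊥`; hence the limit satisfies `B∞ ⊥ B∞ ≤ B∞`, as
every `Bₙ ⊥ Bₘ = Bₙ₊ₘ` is dominated by `B∞`, and this is the comultiplication. Being a magic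
unitary is inherited by `⊥` and by the limit, which gives the arrow from `C(S_N⁺)`.

The quotient of `R_{(a,b),(c,d)}` at `p = q = 1` is the identity matrix and at `p = 0`, `q = 1` is
the matrix of the transposition `(a b)`. Products of these quotients show that `M₁`, and with it
`B∞`, dominates the matrix of every permutation, which gives the arrow to `C(S_N)`, and that it
dominates every `R_{(a,b),*}` itself. Since `p` and `q` do not commute, `B∞` is not commutative,
whereas `C(S_N)` is, so the second arrow is not injective.
-/

noncomputable section

namespace QPerm

section PositiveFunctionals

open scoped ComplexOrder ComplexStarModule

variable {A : Type*} [CStarAlgebra A] [PartialOrder A] [StarOrderedRing A]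

theorem exists_positiveLinearMap_eq_of_isSelfAdjoint (f : A →ₗ[ℝ] ℝ)
    (hf : ∀ a, 0 ≤ a → 0 ≤ f a) :
    ∃ g : A →ₚ[ℂ] ℂ, ∀ a, IsSelfAdjoint a → g a = f a := by
  let re : A →ₗ[ℝ] A := (selfAdjoint.submodule ℝ A).subtype ∘ₗ realPart
  let g : A →ₗ[ℂ] ℂ := Module.Dual.extendRCLike (𝕜 := ℂ) (f ∘ₗ re)
  have hg (a : A) (ha : IsSelfAdjoint a) : g a = f a := by
    have hre : re a = a := ha.coe_realPart
    have hre_I : re (Complex.I • a) = 0 := by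
      change (ℜ (Complex.I • a) : A) = 0
      rw [realPart_I_smul, ha.imaginaryPart, neg_zero, ZeroMemClass.coe_zero]
    simp [g, Module.Dual.extendRCLike_apply, hre, hre_I]
  exact ⟨.mk₀ g fun a ha => by
    rw [hg a (.of_nonneg ha)]; exact_mod_cast hf a ha, hg⟩

theorem exists_positiveLinearMap_ne_zero {a : A} (ha : 0 ≤ a) (ha0 : a ≠ 0) :
    ∃ g : A →ₚ[ℂ] ℂ, g a ≠ 0 := by
  let C : ProperCone ℝ A :=
    { carrier := {x | 0 ≤ x}
      add_mem' := add_nonneg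
      zero_mem' := le_rfl
      smul_mem' := fun c _ hx => smul_nonneg c.2 hx
      isClosed' := CStarAlgebra.isClosed_nonneg }
  have neg_notMem : -a ∉ C := fun h => ha0 (le_antisymm (neg_nonneg.1 h) ha)
  obtain ⟨f, hf_nonneg, hf_neg⟩ := C.hyperplane_separation_point neg_notMem
  obtain ⟨g, hg⟩ := exists_positiveLinearMap_eq_of_isSelfAdjoint (f : A →ₗ[ℝ] ℝ) hf_nonneg
  refine ⟨g, ?_⟩
  rw [hg a (.of_nonneg ha)]
  rw [map_neg, Left.neg_neg_iff] at hf_neg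
  exact_mod_cast hf_neg.ne'

theorem ne_zero_of_gnsStarAlgHom (f : A →ₚ[ℂ] ℂ) {a : A} (ha : f (star a * a) ≠ 0) :
    f.gnsStarAlgHom a ≠ 0 := by
  intro h
  have norm_eq_zero : ‖f.leftMulMapPreGNS a (f.toPreGNS 1)‖ = 0 := by
    rw [← UniformSpace.Completion.norm_coe, ← f.gnsNonUnitalStarAlgHom_apply_coe]
    exact norm_eq_zero.2 (congrArg (fun T => T (f.toPreGNS 1 : f.GNS)) h)
  have norm_sq := f.preGNS_norm_sq (f.leftMulMapPreGNS a (f.toPreGNS 1))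
  rw [norm_eq_zero] at norm_sq
  exact ha (by simpa using norm_sq.symm)

end PositiveFunctionals

namespace CStarSeminorm

section Lift

variable {R : Type*} [Ring R] [StarRing R] [Algebra ℂ R] [StarModule ℂ R]

theorem exists_lift (p : CStarSeminorm R) {D : Type*} [NormedRing D] [StarRing D]
    [NormedStarGroup D] [NormedAlgebra ℂ D] [CompleteSpace D] (φ : R →⋆ₐ[ℂ] D)
    (h : ∀ x, ‖φ x‖ ≤ p.toFun x) : ∃ ψ : p.Compl →⋆ₐ[ℂ] D, ∀ x, ψ (p.toCompl x) = φ x := by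
  let φ' : p.Pre →+* D := (φ : R →+* D)
  have hφ : Continuous φ' :=
    AddMonoidHomClass.continuous_of_bound φ' 1 fun x => (h x).trans_eq (one_mul _).symm
  let ψ : p.Compl →+* D := UniformSpace.Completion.extensionHom φ' hφ
  have hψ : Continuous ψ := UniformSpace.Completion.continuous_extension
  have ψ_coe : ∀ x, ψ (p.coe x) = φ x := fun x => UniformSpace.Completion.extensionHom_coe φ' hφ _
  have := p.continuous_star
  refine ⟨{ ψ with
    commutes' := fun c => ?_
    map_star' := fun a => ?_ }, ψ_coe⟩
  · change ψ (algebraMap ℂ p.Compl c) = _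
    rw [Algebra.algebraMap_eq_smul_one, Algebra.algebraMap_eq_smul_one]
    change ψ (c • p.coe 1) = _
    rw [← coe_smul, ψ_coe, map_smul, map_one]
  · change ψ (star a) = star (ψ a)
    induction a using ind with
    | hP => exact isClosed_eq (by fun_prop) (by fun_prop)
    | h x => rw [star_coe, ψ_coe, ψ_coe, map_star]

theorem exists_lift_operator (p : CStarSeminorm R) {H : Type*} [NormedAddCommGroup H]
    [InnerProductSpace ℂ H] [CompleteSpace H] (φ : R →⋆ₐ[ℂ] (H →L[ℂ] H))
    (h : ∀ x, ‖φ x‖ ≤ p.toFun x) :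
    ∃ ψ : p.Compl →⋆ₐ[ℂ] (H →L[ℂ] H), ∀ x, ψ (p.toCompl x) = φ x :=
  p.exists_lift φ h

end Lift

variable {B : Type*} [CStarAlgebra B]

theorem le_norm (p : CStarSeminorm B) (x : B) : p.toFun x ≤ ‖x‖ := by
  rw [← p.norm_coe]
  exact NonUnitalStarAlgHom.norm_apply_le p.toCompl x

/-- The supremum of the family is a C⋆-norm, and the C⋆-norm of a C⋆-algebra is unique. -/
theorem norm_le_of_separating {ι : Sort*} (p : ι → CStarSeminorm B)
    (hp : ∀ x, (∀ i, (p i).toFun x = 0) → x = 0) (x : B) {C : ℝ} (hC : 0 ≤ C)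
    (h : ∀ i, (p i).toFun x ≤ C) : ‖x‖ ≤ C := by
  have bdd (x : B) : BddAbove (Set.range fun i => (p i).toFun x) :=
    ⟨‖x‖, Set.forall_mem_range.2 fun i => (p i).le_norm x⟩
  let q := CStarSeminorm.iSup p bdd
  have injective_toCompl : Function.Injective q.toCompl := by
    refine (injective_iff_map_eq_zero _).2 fun y hy => hp y fun i => ?_
    have hqy : q.toFun y = 0 := by rw [← q.norm_coe]; exact norm_eq_zero.2 hy
    exact le_antisymm (hqy ▸ le_ciSup (bdd y) i) ((p i).nonneg y)
  calc ‖x‖ = ‖q.toCompl x‖ := (NonUnitalStarAlgHom.norm_map q.toCompl injective_toCompl x).symm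
    _ = q.toFun x := q.norm_coe x
    _ ≤ C := Real.iSup_le h hC

end CStarSeminorm

/-- A unital *-representation of a C⋆-algebra on a Hilbert space. -/
structure Rep (A : Type) [CStarAlgebra A] where
  H : Type
  [normed : NormedAddCommGroup H]
  [innerProd : InnerProductSpace ℂ H]
  [complete : CompleteSpace H]
  π : A →⋆ₐ[ℂ] (H →L[ℂ] H)

attribute [instance] Rep.normed Rep.innerProd Rep.complete

namespace Rep

variable {A B : Type} [CStarAlgebra A] [CStarAlgebra B]

/-- A set of representations separates the points of the C⋆-algebra, i.e. its direct sum is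
faithful. -/
def Separating (S : Set (Rep A)) : Prop := ∀ a, (∀ ρ ∈ S, ρ.π a = 0) → a = 0

theorem separating_univ : Separating (Set.univ : Set (Rep A)) := by
  intro a h
  by_contra ha
  let _ := CStarAlgebra.spectralOrder A
  have := CStarAlgebra.spectralOrderedRing A
  obtain ⟨f, hf⟩ := exists_positiveLinearMap_ne_zero (star_mul_self_nonneg a) (by simpa using ha)
  exact ne_zero_of_gnsStarAlgHom f hf (h ⟨f.GNS, f.gnsStarAlgHom⟩ trivial)

/-- The restriction of a representation along a *-homomorphism. -/
def comp (σ : Rep B) (φ : A →⋆ₐ[ℂ] B) : Rep A := ⟨σ.H, σ.π.comp φ⟩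

/-- The product representation `ρ ⊗ σ` of the algebraic tensor product, acting on the algebraic
tensor product of the Hilbert spaces. -/
def tensorOp (ρ : Rep A) (σ : Rep B) : A ⊗[ℂ] B →ₐ[ℂ] (ρ.H ⊗[ℂ] σ.H →L[ℂ] ρ.H ⊗[ℂ] σ.H) :=
  RepPair.rep ⟨ρ.H, σ.H, ρ.π, σ.π⟩

theorem tensorOp_tmul (ρ : Rep A) (σ : Rep B) (a : A) (b : B) :
    ρ.tensorOp σ (a ⊗ₜ b) = TensorProduct.mapL (ρ.π a) (σ.π b) :=
  RepPair.rep_tmul ..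

theorem inner_tensorOp (ρ : Rep A) (σ : Rep B) (x : A ⊗[ℂ] B) (v w : ρ.H ⊗[ℂ] σ.H) :
    inner ℂ (ρ.tensorOp σ x v) w = inner ℂ v (ρ.tensorOp σ (star x) w) :=
  RepPair.inner_rep ⟨ρ.H, σ.H, ρ.π, σ.π⟩ x v w

theorem norm_tensorOp_le_minNorm (ρ : Rep A) (σ : Rep B) (x : A ⊗[ℂ] B) :
    ‖ρ.tensorOp σ x‖ ≤ (minNorm A B).toFun x :=
  le_ciSup (RepPair.bddAbove x) ⟨ρ.H, σ.H, ρ.π, σ.π⟩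

section Amplification

variable {ι : Type} [Fintype ι]

/-- The amplification of `σ` to matrices over `B`, which act on `ι`-indexed columns of vectors. -/
def matOp (σ : Rep B) (Y : CStarMatrix ι ι B) :
    PiLp 2 (fun _ : ι => σ.H) →L[ℂ] PiLp 2 (fun _ : ι => σ.H) :=
  (PiLp.continuousLinearEquiv 2 ℂ fun _ : ι => σ.H).symm.toContinuousLinearMap ∘L
    ContinuousLinearMap.pi fun i => ∑ j, σ.π (Y i j) ∘L PiLp.proj 2 (fun _ : ι => σ.H) j

theorem matOp_apply (σ : Rep B) (Y : CStarMatrix ι ι B) (v : PiLp 2 fun _ : ι => σ.H) (i : ι) :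
    σ.matOp Y v i = ∑ j, σ.π (Y i j) (v j) := by
  simp [matOp]

theorem matOp_add (σ : Rep B) (Y Z : CStarMatrix ι ι B) :
    σ.matOp (Y + Z) = σ.matOp Y + σ.matOp Z := by
  ext v i
  simp [matOp_apply, Finset.sum_add_distrib]

theorem matOp_smul (σ : Rep B) (c : ℂ) (Y : CStarMatrix ι ι B) :
    σ.matOp (c • Y) = c • σ.matOp Y := by
  ext v i
  simp [matOp_apply, Finset.smul_sum]

theorem matOp_mul (σ : Rep B) (Y Z : CStarMatrix ι ι B) :
    σ.matOp (Y * Z) = σ.matOp Y * σ.matOp Z := by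
  ext v i
  simp only [mul_apply_eq_comp, matOp_apply, CStarMatrix.mul_apply, map_sum, map_mul, sum_apply]
  exact Finset.sum_comm

theorem inner_matOp (σ : Rep B) (Y : CStarMatrix ι ι B) (v w : PiLp 2 fun _ : ι => σ.H) :
    inner ℂ (σ.matOp Y v) w = inner ℂ v (σ.matOp (star Y) w) := by
  simp only [PiLp.inner_apply, matOp_apply, sum_inner, inner_sum, CStarMatrix.star_apply, map_star,
    ContinuousLinearMap.star_eq_adjoint, ContinuousLinearMap.adjoint_inner_right]
  exact Finset.sum_comm

theorem π_apply_eq_zero_of_matOp_eq_zero (σ : Rep B) {Y : CStarMatrix ι ι B} (hY : σ.matOp Y = 0)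
    (i j : ι) : σ.π (Y i j) = 0 := by
  classical
  ext k
  have h := σ.matOp_apply Y (WithLp.toLp 2 (Pi.single j k)) i
  rw [hY, Finset.sum_eq_single j (fun l _ hl => by simp [hl]) (by simp)] at h
  simpa using h.symm

/-- The C⋆-seminorm of the amplification `matOp`. -/
def matSeminorm (σ : Rep B) (ι : Type) [Fintype ι] [DecidableEq ι] :
    CStarSeminorm (CStarMatrix ι ι B) where
  toFun Y := ‖σ.matOp Y‖
  add_le Y Z := by rw [matOp_add]; exact norm_add_le _ _
  smul c Y := by rw [matOp_smul, norm_smul]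
  mul_le Y Z := by rw [matOp_mul]; exact norm_mul_le _ _
  star_mul_self Y := by
    rw [matOp_mul]
    exact opNorm_adj_mul_self _ _ (σ.inner_matOp Y)

theorem norm_matOp_le_of_separating {S : Set (Rep B)} (hS : Separating S) (σ : Rep B)
    (Y : CStarMatrix ι ι B) {C : ℝ} (hC : 0 ≤ C) (h : ∀ τ ∈ S, ‖τ.matOp Y‖ ≤ C) :
    ‖σ.matOp Y‖ ≤ C := by
  classical
  let _ := CStarAlgebra.spectralOrder B
  have := CStarAlgebra.spectralOrderedRing B
  have separating (Z : CStarMatrix ι ι B) (hZ : ∀ τ : S, (τ.1.matSeminorm ι).toFun Z = 0) :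
      Z = 0 := by
    ext i j
    exact hS _ fun τ hτ => τ.π_apply_eq_zero_of_matOp_eq_zero (norm_eq_zero.1 (hZ ⟨τ, hτ⟩)) i j
  calc ‖σ.matOp Y‖ ≤ ‖Y‖ := (σ.matSeminorm ι).le_norm Y
    _ ≤ C := CStarSeminorm.norm_le_of_separating _ separating Y hC fun τ => h τ.1 τ.2

end Amplification

theorem re_inner_apply_le {E : Type*} [NormedAddCommGroup E] [InnerProductSpace ℂ E] (T : E →L[ℂ] E)
    {v w : E} (hv : ‖v‖ = 1) (hw : ‖w‖ = 1) : RCLike.re (inner ℂ (T v) w) ≤ ‖T‖ :=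
  calc RCLike.re (inner ℂ (T v) w) ≤ ‖T v‖ * ‖w‖ := re_inner_le_norm (𝕜 := ℂ) _ _
    _ ≤ ‖T‖ := by simpa [hv, hw] using T.le_opNorm v

section Compression

variable {ι : Type}

/-- The vector functional `a ↦ ⟪v, ρ(a) w⟫`. -/
def vectorFunctional (ρ : Rep A) (v w : ρ.H) : A →ₗ[ℂ] ℂ :=
  (innerSL ℂ v).toLinearMap ∘ₗ (ContinuousLinearMap.apply ℂ ρ.H w).toLinearMap ∘ₗ
    ρ.π.toAlgHom.toLinearMap

/-- The compression of `x` to the span of `e`, as a matrix over `B`: its `(i, j)` entry is the slice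
of `x` by the vector functional of `e i` and `e j`. -/
def compress (ρ : Rep A) (e : ι → ρ.H) (x : A ⊗[ℂ] B) : CStarMatrix ι ι B :=
  CStarMatrix.ofMatrix fun i j =>
    TensorProduct.lid ℂ B (LinearMap.rTensor B (ρ.vectorFunctional (e i) (e j)) x)

theorem compress_apply (ρ : Rep A) (e : ι → ρ.H) (x : A ⊗[ℂ] B) (i j : ι) :
    ρ.compress e x i j =
      TensorProduct.lid ℂ B (LinearMap.rTensor B (ρ.vectorFunctional (e i) (e j)) x) :=
  rfl

variable [Fintype ι] {H K : Type} [NormedAddCommGroup H] [InnerProductSpace ℂ H]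
  [NormedAddCommGroup K] [InnerProductSpace ℂ K]

/-- The isometry `v ↦ ∑ i, e i ⊗ v i` given by an orthonormal family `e`. -/
def expand {e : ι → H} (he : Orthonormal ℂ e) : PiLp 2 (fun _ : ι => K) →ₗᵢ[ℂ] H ⊗[ℂ] K :=
  LinearMap.isometryOfInner
    (∑ i, (TensorProduct.mk ℂ H K (e i)) ∘ₗ (PiLp.proj 2 (fun _ : ι => K) i).toLinearMap)
    (fun v w => by
      classical
      simp [sum_inner, inner_sum, PiLp.inner_apply, orthonormal_iff_ite.1 he])

theorem expand_apply {e : ι → H} (he : Orthonormal ℂ e) (v : PiLp 2 fun _ : ι => K) :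
    expand he v = ∑ i, e i ⊗ₜ v i := by
  simp [expand]

theorem exists_orthonormal_expand_eq (v w : H ⊗[ℂ] K) :
    ∃ (n : ℕ) (e : Fin n → H) (he : Orthonormal ℂ e),
      v ∈ Set.range (expand (K := K) he) ∧ w ∈ Set.range (expand (K := K) he) := by
  obtain ⟨F, G, _, _, hFG⟩ := TensorProduct.exists_finite_submodule_of_setFinite {v, w}
    (Set.toFinite _)
  let b := stdOrthonormalBasis ℂ F
  have mem_range (u : F ⊗[ℂ] G) : TensorProduct.mapIncl F G u ∈
      Set.range (expand (K := K) (b.orthonormal.comp_linearIsometry F.subtypeₗᵢ)) := by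
    obtain ⟨c, rfl⟩ := TensorProduct.eq_repr_basis_left b.toBasis u
    refine ⟨WithLp.toLp 2 fun i => c i, ?_⟩
    rw [expand_apply]
    simp [Finsupp.sum_fintype, TensorProduct.mapIncl]
  obtain ⟨v', rfl⟩ := hFG (Set.mem_insert v _)
  obtain ⟨w', rfl⟩ := hFG (Set.mem_insert_of_mem _ rfl)
  exact ⟨_, _, b.orthonormal.comp_linearIsometry F.subtypeₗᵢ, mem_range v', mem_range w'⟩

theorem inner_tensorOp_expand (ρ : Rep A) (σ : Rep B) {e : ι → ρ.H} (he : Orthonormal ℂ e)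
    (x : A ⊗[ℂ] B) (v w : PiLp 2 fun _ : ι => σ.H) :
    inner ℂ (ρ.tensorOp σ x (expand he v)) (expand he w) =
      inner ℂ (σ.matOp (ρ.compress e x) v) w := by
  induction x using TensorProduct.induction_on with
  | zero => simp [PiLp.inner_apply, matOp_apply, compress_apply]
  | add x y hx hy =>
    have compress_add : ρ.compress e (x + y) = ρ.compress e x + ρ.compress e y := by
      ext i j
      simp [compress_apply]
    rw [map_add, add_apply, inner_add_left, hx, hy, compress_add, matOp_add, add_apply,
      inner_add_left]
  | tmul a b =>
    simp only [expand_apply, map_sum, tensorOp_tmul, sum_inner, inner_sum, PiLp.inner_apply,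
      matOp_apply, TensorProduct.mapL_tmul, TensorProduct.inner_tmul]
    refine Finset.sum_congr rfl fun i _ => Finset.sum_congr rfl fun j _ => ?_
    simp [compress_apply, vectorFunctional, inner_smul_left]

end Compression

theorem norm_matOp_compress_le (ρ : Rep A) (σ : Rep B) {ι : Type} [Fintype ι] {e : ι → ρ.H}
    (he : Orthonormal ℂ e) (x : A ⊗[ℂ] B) : ‖σ.matOp (ρ.compress e x)‖ ≤ ‖ρ.tensorOp σ x‖ := by
  refine ContinuousLinearMap.opNorm_le_of_re_inner_le (ContinuousLinearMap.opNorm_nonneg _)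
    fun v w hv hw => ?_
  rw [← inner_tensorOp_expand ρ σ he]
  exact re_inner_apply_le _ (by rwa [LinearIsometry.norm_map]) (by rwa [LinearIsometry.norm_map])

theorem norm_tensorOp_le_of_compress (ρ : Rep A) (σ : Rep B) (x : A ⊗[ℂ] B) {C : ℝ} (hC : 0 ≤ C)
    (h : ∀ (n : ℕ) (e : Fin n → ρ.H), Orthonormal ℂ e → ‖σ.matOp (ρ.compress e x)‖ ≤ C) :
    ‖ρ.tensorOp σ x‖ ≤ C := by
  refine ContinuousLinearMap.opNorm_le_of_re_inner_le hC fun v w hv hw => ?_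
  obtain ⟨n, e, he, ⟨v', rfl⟩, ⟨w', rfl⟩⟩ := exists_orthonormal_expand_eq v w
  rw [LinearIsometry.norm_map] at hv hw
  rw [inner_tensorOp_expand ρ σ he]
  exact (re_inner_apply_le _ hv hw).trans (h n e he)

/-- Compressing the first leg to finite-dimensional subspaces turns the norms into norms of matrices
over `B`, and the C⋆-norm of those is unique. -/
theorem norm_tensorOp_le_of_separating_right {S : Set (Rep B)} (hS : Separating S) (ρ : Rep A)
    (σ : Rep B) (x : A ⊗[ℂ] B) {C : ℝ} (hC : 0 ≤ C) (h : ∀ τ ∈ S, ‖ρ.tensorOp τ x‖ ≤ C) :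
    ‖ρ.tensorOp σ x‖ ≤ C :=
  ρ.norm_tensorOp_le_of_compress σ x hC fun _ _ he =>
    norm_matOp_le_of_separating hS σ _ hC fun τ hτ =>
      (ρ.norm_matOp_compress_le τ he x).trans (h τ hτ)

theorem tensorOp_comm (ρ : Rep A) (σ : Rep B) (x : A ⊗[ℂ] B) (v : ρ.H ⊗[ℂ] σ.H) :
    σ.tensorOp ρ (TensorProduct.comm ℂ A B x) (TensorProduct.comm ℂ ρ.H σ.H v) =
      TensorProduct.comm ℂ ρ.H σ.H (ρ.tensorOp σ x v) := by
  induction x using TensorProduct.induction_on with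
  | zero => simp
  | add x y hx hy => simp only [map_add, add_apply, hx, hy]
  | tmul a b =>
    induction v using TensorProduct.induction_on with
    | zero => simp
    | add v w hv hw => simp only [map_add, hv, hw]
    | tmul h k => simp only [TensorProduct.comm_tmul, tensorOp_tmul, TensorProduct.mapL_tmul]

theorem norm_tensorOp_comm (ρ : Rep A) (σ : Rep B) (x : A ⊗[ℂ] B) :
    ‖σ.tensorOp ρ (TensorProduct.comm ℂ A B x)‖ = ‖ρ.tensorOp σ x‖ := by
  have le {A B : Type} [CStarAlgebra A] [CStarAlgebra B] (ρ : Rep A) (σ : Rep B) (x : A ⊗[ℂ] B) :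
      ‖ρ.tensorOp σ x‖ ≤ ‖σ.tensorOp ρ (TensorProduct.comm ℂ A B x)‖ := by
    refine ContinuousLinearMap.opNorm_le_bound _ (ContinuousLinearMap.opNorm_nonneg _) fun v => ?_
    rw [← TensorProduct.norm_comm (ρ.tensorOp σ x v), ← tensorOp_comm,
      ← TensorProduct.norm_comm v]
    exact ContinuousLinearMap.le_opNorm _ _
  exact le_antisymm ((le σ ρ _).trans_eq (by rw [TensorProduct.comm_comm])) (le ρ σ x)

theorem norm_tensorOp_le_of_separating_left {S : Set (Rep A)} (hS : Separating S) (ρ : Rep A)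
    (σ : Rep B) (x : A ⊗[ℂ] B) {C : ℝ} (hC : 0 ≤ C) (h : ∀ τ ∈ S, ‖τ.tensorOp σ x‖ ≤ C) :
    ‖ρ.tensorOp σ x‖ ≤ C := by
  rw [← norm_tensorOp_comm]
  refine norm_tensorOp_le_of_separating_right hS σ ρ _ hC fun τ hτ => ?_
  rw [norm_tensorOp_comm]
  exact h τ hτ

theorem minNorm_le_of_separating {S : Set (Rep A)} (hS : Separating S) {T : Set (Rep B)}
    (hT : Separating T) (x : A ⊗[ℂ] B) {C : ℝ} (hC : 0 ≤ C)
    (h : ∀ ρ ∈ S, ∀ σ ∈ T, ‖ρ.tensorOp σ x‖ ≤ C) : (minNorm A B).toFun x ≤ C :=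
  Real.iSup_le (fun r => norm_tensorOp_le_of_separating_left hS ⟨r.H, r.ξ⟩ ⟨r.K, r.η⟩ x hC
    fun ρ hρ => norm_tensorOp_le_of_separating_right hT ρ _ x hC fun σ hσ => h ρ hρ σ hσ) hC

end Rep

namespace FreeStar

section Algebra

variable {X : Type} {D : Type*} [Ring D] [Algebra ℂ D]

theorem adjoin_gen_union_star_gen :
    Algebra.adjoin ℂ (Set.range gen ∪ Set.range fun x : X => star (gen x)) = ⊤ := by
  refine Algebra.eq_top_iff.2 fun a => ?_
  induction a using ind with
  | hadd a b ha hb => exact add_mem ha hb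
  | hm w c =>
    rw [← mul_one c, ← smul_mono]
    refine Subalgebra.smul_mem _ ?_ c
    induction w using FreeMonoid.inductionOn' with
    | one => exact one_mem _
    | of_mul x w ih =>
      rw [← mul_one (1 : ℂ), ← mono_mul]
      refine mul_mem (Algebra.subset_adjoin ?_) ih
      rcases x with x | x
      · exact .inl ⟨x, rfl⟩
      · exact .inr ⟨x, by simp only [gen, star_mono, star_one]; rfl⟩

theorem algHom_ext {φ ψ : FreeStar X →ₐ[ℂ] D} (hgen : ∀ x, φ (gen x) = ψ (gen x))
    (hstar : ∀ x, φ (star (gen x)) = ψ (star (gen x))) : φ = ψ := by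
  refine AlgHom.ext_of_adjoin_eq_top adjoin_gen_union_star_gen ?_
  rintro _ (⟨x, rfl⟩ | ⟨x, rfl⟩)
  exacts [hgen x, hstar x]

variable [StarRing D] [StarModule ℂ D]

theorem algHom_comp_eval {D' : Type*} [Ring D'] [StarRing D'] [Algebra ℂ D'] [StarModule ℂ D']
    (φ : D →ₐ[ℂ] D') {f : X → D} {g : X → D'} (h : ∀ x, φ (f x) = g x)
    (hstar : ∀ x, φ (star (f x)) = star (g x)) :
    φ.comp (eval f).toAlgHom = (eval g).toAlgHom :=
  algHom_ext (fun x => by simp [eval_gen, h]) (fun x => by simp [map_star, eval_gen, hstar])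

theorem map_eval {D' : Type*} [Ring D'] [StarRing D'] [Algebra ℂ D'] [StarModule ℂ D']
    (φ : D →⋆ₐ[ℂ] D') {f : X → D} {g : X → D'} (h : ∀ x, φ (f x) = g x) (a : FreeStar X) :
    φ (eval f a) = eval g a :=
  DFunLike.congr_fun (algHom_comp_eval φ.toAlgHom h fun x => by simp [map_star, h]) a

theorem eval_comp_gen (φ : FreeStar X →⋆ₐ[ℂ] D) : eval (fun x => φ (gen x)) = φ :=
  StarAlgHom.ext fun a => DFunLike.congr_fun (algHom_ext (φ := (eval _).toAlgHom)
    (ψ := φ.toAlgHom) (fun x => by simp [eval_gen]) (fun x => by simp [map_star, eval_gen])) a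

theorem eval_mem (S : Subalgebra ℂ D) {f : X → D} (h : ∀ x, f x ∈ S) (hstar : ∀ x, star (f x) ∈ S)
    (a : FreeStar X) : eval f a ∈ S := by
  have le_comap : ⊤ ≤ S.comap (eval f).toAlgHom := by
    rw [← adjoin_gen_union_star_gen, Algebra.adjoin_le_iff]
    rintro _ (⟨x, rfl⟩ | ⟨x, rfl⟩)
    · simpa [eval_gen] using h x
    · simpa [map_star, eval_gen] using hstar x
  exact le_comap Algebra.mem_top

end Algebra

end FreeStar

theorem eq_zero_of_forall_map_eq_zero_of_dense {ι : Sort*} {B : Type*} [CStarAlgebra B]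
    {D : ι → Type*} [∀ i, CStarAlgebra (D i)] (φ : ∀ i, B →⋆ₐ[ℂ] D i) {s : Set B} (hs : Dense s)
    (norm_le : ∀ x ∈ s, ∀ C : ℝ, 0 ≤ C → (∀ i, ‖φ i x‖ ≤ C) → ‖x‖ ≤ C) (a : B)
    (ha : ∀ i, φ i a = 0) : a = 0 := by
  rw [← norm_le_zero_iff]
  refine le_of_forall_pos_le_add fun ε hε => ?_
  obtain ⟨x, hx, dist_lt⟩ := Metric.mem_closure_iff.1 (hs a) (ε / 2) (half_pos hε)
  rw [dist_eq_norm] at dist_lt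
  have norm_x_le : ‖x‖ ≤ ε / 2 := norm_le x hx _ (half_pos hε).le fun i => by
    have map_x : φ i x = -φ i (a - x) := by rw [map_sub, ha, zero_sub, neg_neg]
    rw [map_x, norm_neg]
    exact (NonUnitalStarAlgHom.norm_apply_le (φ i) _).trans dist_lt.le
  linarith [norm_le_norm_sub_add a x]

namespace Rep

variable {A B A' B' : Type} [CStarAlgebra A] [CStarAlgebra B] [CStarAlgebra A'] [CStarAlgebra B']

theorem tensorOp_comp (ρ : Rep A') (σ : Rep B') (φ : A →⋆ₐ[ℂ] A') (ψ : B →⋆ₐ[ℂ] B') :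
    (ρ.comp φ).tensorOp (σ.comp ψ) =
      (ρ.tensorOp σ).comp (Algebra.TensorProduct.map φ.toAlgHom ψ.toAlgHom) :=
  Algebra.TensorProduct.ext' fun a b =>
    (tensorOp_tmul ..).trans (tensorOp_tmul ρ σ (φ a) (ψ b)).symm

theorem separating_of_homs {ι : Sort*} {D : ι → Type} [∀ i, CStarAlgebra (D i)]
    (φ : ∀ i, A →⋆ₐ[ℂ] D i) (h : ∀ a, (∀ i, φ i a = 0) → a = 0) :
    Separating {ρ : Rep A | ∃ i, ∃ τ : Rep (D i), ρ = τ.comp (φ i)} :=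
  fun a ha => h a fun i => separating_univ _ fun τ _ => ha _ ⟨i, τ, rfl⟩

end Rep

namespace MatPair

variable {N : ℕ}

/-- The evaluation of *-polynomials in `N²` variables at the entries of the matrix. -/
def ev (P : MatPair N) : FreeStar (Fin N × Fin N) →⋆ₐ[ℂ] P.D :=
  FreeStar.eval fun ij => P.M ij.1 ij.2

theorem ev_gen (P : MatPair N) (i j : Fin N) : P.ev (FreeStar.gen (i, j)) = P.M i j :=
  FreeStar.eval_gen _ _

/-- Domination of pairs: `P ≤ Q` if no *-polynomial has larger norm at the entries of `P` than at
those of `Q`. When the entries of `Q` generate its algebra, this amounts to the existence of an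
arrow from `Q` to `P`. -/
instance : Preorder (MatPair N) where
  le P Q := ∀ f, ‖P.ev f‖ ≤ ‖Q.ev f‖
  le_refl _ _ := le_rfl
  le_trans _ _ _ hPQ hQR f := (hPQ f).trans (hQR f)

theorem Arrow.map_ev {P Q : MatPair N} (φ : P.Arrow Q) (f : FreeStar (Fin N × Fin N)) :
    φ.hom (P.ev f) = Q.ev f :=
  FreeStar.map_eval (f := fun ij : Fin N × Fin N => P.M ij.1 ij.2) φ.hom
    (g := fun ij : Fin N × Fin N => Q.M ij.1 ij.2) (fun ij => φ.map_entry ij.1 ij.2) f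

theorem Arrow.le {P Q : MatPair N} (φ : P.Arrow Q) : Q ≤ P := fun f => by
  rw [← φ.map_ev]
  exact NonUnitalStarAlgHom.norm_apply_le φ.hom _

theorem Arrow.le_of_injective {P Q : MatPair N} (φ : P.Arrow Q)
    (h : Function.Injective φ.hom) : P ≤ Q := fun f => by
  rw [← φ.map_ev, NonUnitalStarAlgHom.norm_map φ.hom h]

theorem le_cut (P : MatPair N) : P ≤ P.cut :=
  Arrow.le ⟨P.entryAlg.subtype, fun _ _ => rfl⟩

theorem cut_le (P : MatPair N) : P.cut ≤ P :=
  Arrow.le_of_injective ⟨P.entryAlg.subtype, fun _ _ => rfl⟩ Subtype.val_injective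

/-- The evaluation of *-polynomials at the entries of `P ⊥ Q` in the algebraic tensor product. -/
def evTensor (P Q : MatPair N) : FreeStar (Fin N × Fin N) →⋆ₐ[ℂ] P.D ⊗[ℂ] Q.D :=
  FreeStar.eval fun ij => ∑ k, P.M ij.1 k ⊗ₜ Q.M k ij.2

theorem toCompl_evTensor (P Q : MatPair N) (f : FreeStar (Fin N × Fin N)) :
    (minNorm P.D Q.D).toCompl (P.evTensor Q f) = (P.oprod Q).ev f :=
  FreeStar.map_eval _ (fun _ => map_sum _ _ _) f

theorem norm_ev_oprod (P Q : MatPair N) (f : FreeStar (Fin N × Fin N)) :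
    ‖(P.oprod Q).ev f‖ = (minNorm P.D Q.D).toFun (P.evTensor Q f) := by
  rw [← toCompl_evTensor]
  exact CStarSeminorm.norm_coe _ _

theorem Arrow.map_evTensor {P P' Q Q' : MatPair N} (φ : P.Arrow P') (ψ : Q.Arrow Q')
    (f : FreeStar (Fin N × Fin N)) :
    Algebra.TensorProduct.map φ.hom.toAlgHom ψ.hom.toAlgHom (P.evTensor Q f) =
      P'.evTensor Q' f := by
  refine DFunLike.congr_fun (FreeStar.algHom_comp_eval
    (f := fun ij : Fin N × Fin N => ∑ k, P.M ij.1 k ⊗ₜ[ℂ] Q.M k ij.2)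
    (g := fun ij : Fin N × Fin N => ∑ k, P'.M ij.1 k ⊗ₜ[ℂ] Q'.M k ij.2)
    (Algebra.TensorProduct.map φ.hom.toAlgHom ψ.hom.toAlgHom) (fun ij => ?_) (fun ij => ?_)) f
  · simp [φ.map_entry, ψ.map_entry]
  · simp [star_sum, map_star, φ.map_entry, ψ.map_entry]

theorem Arrow.norm_tensorOp_comp_evTensor {P P' Q Q' : MatPair N} (φ : P.Arrow P') (ψ : Q.Arrow Q')
    (ρ : Rep P'.D) (σ : Rep Q'.D) (f : FreeStar (Fin N × Fin N)) :
    ‖(ρ.comp φ.hom).tensorOp (σ.comp ψ.hom) (P.evTensor Q f)‖ =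
      ‖ρ.tensorOp σ (P'.evTensor Q' f)‖ := by
  rw [← φ.map_evTensor ψ, Rep.tensorOp_comp]
  rfl

theorem norm_tensorOp_evTensor_le {P Q : MatPair N} (ρ : Rep P.D) (σ : Rep Q.D)
    (f : FreeStar (Fin N × Fin N)) : ‖ρ.tensorOp σ (P.evTensor Q f)‖ ≤ ‖(P.oprod Q).ev f‖ := by
  rw [norm_ev_oprod]
  exact Rep.norm_tensorOp_le_minNorm _ _ _

theorem Arrow.oprod_le {P P' Q Q' : MatPair N} (φ : P.Arrow P') (ψ : Q.Arrow Q') :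
    P'.oprod Q' ≤ P.oprod Q := fun f => by
  rw [norm_ev_oprod]
  refine Rep.minNorm_le_of_separating Rep.separating_univ Rep.separating_univ _ (norm_nonneg _)
    fun ρ _ σ _ => ?_
  rw [← φ.norm_tensorOp_comp_evTensor ψ]
  exact norm_tensorOp_evTensor_le _ _ f

section InverseLimit

variable (P : ℕ → MatPair N) (hP : ∀ i j, ∃ C : ℝ, ∀ n, ‖(P n).M i j‖ ≤ C)

/-- The C⋆-seminorm `f ↦ sup_n ‖f(P n)‖` whose completion is the algebra of `invLimit P hP`. -/
def limitSeminorm : CStarSeminorm (FreeStar (Fin N × Fin N)) :=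
  CStarSeminorm.iSup (fun n => CStarSeminorm.ofHom (P n).ev)
    (FreeStar.bddAbove_eval (fun n (ij : Fin N × Fin N) => (P n).M ij.1 ij.2)
      fun ij => hP ij.1 ij.2)

theorem invLimit_ev (f : FreeStar (Fin N × Fin N)) :
    (invLimit P hP).ev f = (limitSeminorm P hP).toCompl f :=
  DFunLike.congr_fun (FreeStar.eval_comp_gen (limitSeminorm P hP).toCompl) f

theorem norm_invLimit_ev (f : FreeStar (Fin N × Fin N)) :
    ‖(invLimit P hP).ev f‖ = ⨆ n, ‖(P n).ev f‖ := by
  rw [invLimit_ev]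
  exact CStarSeminorm.norm_coe _ _

theorem le_invLimit (n : ℕ) : P n ≤ invLimit P hP := fun f => by
  rw [norm_invLimit_ev]
  exact le_ciSup (FreeStar.bddAbove_eval (fun n (ij : Fin N × Fin N) => (P n).M ij.1 ij.2)
    (fun ij => hP ij.1 ij.2) f) n

theorem dense_range_invLimit_ev : Dense (Set.range (invLimit P hP).ev) := by
  refine (CStarSeminorm.denseRange_coe _).mono ?_
  rintro _ ⟨f, rfl⟩
  exact ⟨f, invLimit_ev P hP f⟩

theorem exists_arrow_of_le_invLimit {Q : MatPair N} (h : Q ≤ invLimit P hP) :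
    Nonempty ((invLimit P hP).Arrow Q) := by
  obtain ⟨ψ, hψ⟩ := (limitSeminorm P hP).exists_lift Q.ev fun f =>
    (h f).trans_eq (norm_invLimit_ev P hP f)
  exact ⟨ψ, fun i j => (hψ _).trans (Q.ev_gen i j)⟩

theorem separating_invLimit (φ : ∀ n, (invLimit P hP).Arrow (P n)) :
    Rep.Separating {ρ : Rep (invLimit P hP).D |
      ∃ n, ∃ τ : Rep (P n).D, ρ = τ.comp (φ n).hom} := by
  refine Rep.separating_of_homs (fun n => (φ n).hom)
    (eq_zero_of_forall_map_eq_zero_of_dense _ (dense_range_invLimit_ev P hP) ?_)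
  rintro _ ⟨f, rfl⟩ C - h
  rw [norm_invLimit_ev]
  exact ciSup_le fun n => by rw [← (φ n).map_ev]; exact h n

variable {P hP}

/-- The representations of the inverse limits that factor through some `P n` and some `Q m` already
determine the minimal tensor norm. -/
theorem invLimit_oprod_invLimit_le {Q : ℕ → MatPair N}
    {hQ : ∀ i j, ∃ C : ℝ, ∀ n, ‖(Q n).M i j‖ ≤ C} {R : MatPair N}
    (h : ∀ n m, (P n).oprod (Q m) ≤ R) : (invLimit P hP).oprod (invLimit Q hQ) ≤ R := fun f => by
  have φ (n : ℕ) := (exists_arrow_of_le_invLimit P hP (le_invLimit P hP n)).some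
  have ψ (m : ℕ) := (exists_arrow_of_le_invLimit Q hQ (le_invLimit Q hQ m)).some
  rw [norm_ev_oprod]
  refine Rep.minNorm_le_of_separating (separating_invLimit P hP φ) (separating_invLimit Q hQ ψ) _
    (norm_nonneg _) ?_
  rintro _ ⟨n, τ, rfl⟩ _ ⟨m, υ, rfl⟩
  rw [(φ n).norm_tensorOp_comp_evTensor (ψ m)]
  exact (norm_tensorOp_evTensor_le τ υ f).trans (h n m f)

end InverseLimit

theorem oprod_le_oprod {P Q P' Q' : MatPair N} (hP : P ≤ P') (hQ : Q ≤ Q') :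
    P.oprod Q ≤ P'.oprod Q' := by
  have bounded (R : MatPair N) (i j : Fin N) : ∃ C : ℝ, ∀ _ : ℕ, ‖R.M i j‖ ≤ C :=
    ⟨_, fun _ => le_rfl⟩
  -- Arrows exist only out of pairs generated by their entries, such as constant inverse limits.
  obtain ⟨φ⟩ := exists_arrow_of_le_invLimit (fun _ => P') (bounded P')
    (hP.trans (le_invLimit (fun _ => P') (bounded P') 0))
  obtain ⟨ψ⟩ := exists_arrow_of_le_invLimit (fun _ => Q') (bounded Q')
    (hQ.trans (le_invLimit (fun _ => Q') (bounded Q') 0))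
  exact (φ.oprod_le ψ).trans (invLimit_oprod_invLimit_le fun _ _ => le_rfl)

end MatPair

section OperatorCompletion

open UniformSpace (Completion)

theorem completion_ext {E F : Type*} [NormedAddCommGroup E] [NormedSpace ℂ E]
    [NormedAddCommGroup F] [NormedSpace ℂ F] {S T : Completion E →L[ℂ] F}
    (h : ∀ v : E, S v = T v) : S = T :=
  DFunLike.coe_injective (Completion.ext S.continuous T.continuous h)

/-- The extension of bounded operators to the completion of the space. -/
def completionHom (E : Type*) [NormedAddCommGroup E] [NormedSpace ℂ E] :
    (E →L[ℂ] E) →ₐ[ℂ] (Completion E →L[ℂ] Completion E) where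
  toFun T := T.completion
  map_one' := completion_ext fun v => by simp
  map_mul' S T := completion_ext fun v => by simp
  map_zero' := completion_ext fun v => by simp
  map_add' S T := completion_ext fun v => by simp [Completion.coe_add]
  commutes' c := completion_ext fun v => by simp [Algebra.algebraMap_eq_smul_one]

variable {E : Type*} [NormedAddCommGroup E]

theorem completionHom_apply_coe [NormedSpace ℂ E] (T : E →L[ℂ] E) (v : E) :
    completionHom E T v = (T v : Completion E) :=
  T.completion_apply_coe v

theorem norm_completionHom [NormedSpace ℂ E] (T : E →L[ℂ] E) : ‖completionHom E T‖ = ‖T‖ := by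
  refine le_antisymm (ContinuousLinearMap.opNorm_le_bound _ (norm_nonneg _) fun v => ?_)
    (ContinuousLinearMap.opNorm_le_bound _ (norm_nonneg _) fun v => ?_)
  · induction v using Completion.induction_on with
    | hp => exact isClosed_le (by fun_prop) (by fun_prop)
    | ih v => simpa only [completionHom_apply_coe, Completion.norm_coe] using T.le_opNorm v
  · simpa only [completionHom_apply_coe, Completion.norm_coe] using
      (completionHom E T).le_opNorm v

theorem star_completionHom [InnerProductSpace ℂ E] {S T : E →L[ℂ] E}
    (h : ∀ v w, inner ℂ (T v) w = inner ℂ v (S w)) :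
    star (completionHom E T) = completionHom E S := by
  rw [ContinuousLinearMap.star_eq_adjoint, eq_comm, ContinuousLinearMap.eq_adjoint_iff]
  intro v w
  induction v, w using Completion.induction_on₂ with
  | hp => exact isClosed_eq (by fun_prop) (by fun_prop)
  | ih v w =>
    simp only [completionHom_apply_coe, Completion.inner_coe]
    rw [← inner_conj_symm, ← h, inner_conj_symm]

end OperatorCompletion

namespace Rep

variable {A B : Type} [CStarAlgebra A] [CStarAlgebra B]

open UniformSpace (Completion)

/-- The product representation of the algebraic tensor product on the Hilbert space completion. -/
def tensorHom (ρ : Rep A) (σ : Rep B) :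
    A ⊗[ℂ] B →⋆ₐ[ℂ] (Completion (ρ.H ⊗[ℂ] σ.H) →L[ℂ] Completion (ρ.H ⊗[ℂ] σ.H)) where
  __ := (completionHom (ρ.H ⊗[ℂ] σ.H)).comp (ρ.tensorOp σ)
  map_star' x := (star_completionHom (ρ.inner_tensorOp σ x)).symm

theorem norm_tensorHom (ρ : Rep A) (σ : Rep B) (x : A ⊗[ℂ] B) :
    ‖ρ.tensorHom σ x‖ = ‖ρ.tensorOp σ x‖ :=
  norm_completionHom _

theorem exists_tensor (ρ : Rep A) (σ : Rep B) :
    ∃ π : MinTensor A B →⋆ₐ[ℂ] (Completion (ρ.H ⊗[ℂ] σ.H) →L[ℂ] Completion (ρ.H ⊗[ℂ] σ.H)),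
      ∀ x, π ((minNorm A B).toCompl x) = ρ.tensorHom σ x :=
  (minNorm A B).exists_lift_operator (ρ.tensorHom σ) fun x =>
    (ρ.norm_tensorHom σ x).trans_le (ρ.norm_tensorOp_le_minNorm σ x)

/-- The product of two representations, as a representation of the minimal tensor product. -/
def tensor (ρ : Rep A) (σ : Rep B) : Rep (MinTensor A B) :=
  ⟨Completion (ρ.H ⊗[ℂ] σ.H), (ρ.exists_tensor σ).choose⟩

theorem tensor_toCompl (ρ : Rep A) (σ : Rep B) (x : A ⊗[ℂ] B) :
    (ρ.tensor σ).π ((minNorm A B).toCompl x) = ρ.tensorHom σ x :=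
  (ρ.exists_tensor σ).choose_spec x

/-- The inclusion of the algebraic tensor product of the Hilbert spaces. -/
def incl (ρ : Rep A) (σ : Rep B) : ρ.H ⊗[ℂ] σ.H →ₗᵢ[ℂ] (ρ.tensor σ).H :=
  Completion.toComplₗᵢ

theorem denseRange_incl (ρ : Rep A) (σ : Rep B) : DenseRange (ρ.incl σ) :=
  Completion.denseRange_coe

theorem tensor_toCompl_incl (ρ : Rep A) (σ : Rep B) (x : A ⊗[ℂ] B) (v : ρ.H ⊗[ℂ] σ.H) :
    (ρ.tensor σ).π ((minNorm A B).toCompl x) (ρ.incl σ v) = ρ.incl σ (ρ.tensorOp σ x v) := by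
  rw [tensor_toCompl]
  exact completionHom_apply_coe _ v

theorem separating_tensor :
    Separating {τ : Rep (MinTensor A B) | ∃ (ρ : Rep A) (σ : Rep B), τ = ρ.tensor σ} := by
  intro z hz
  refine eq_zero_of_forall_map_eq_zero_of_dense (fun r : Rep A × Rep B => (r.1.tensor r.2).π)
    (minNorm A B).denseRange_coe ?_ z fun r => hz _ ⟨r.1, r.2, rfl⟩
  rintro _ ⟨x, rfl⟩ C hC h
  rw [CStarSeminorm.norm_coe]
  refine minNorm_le_of_separating separating_univ separating_univ x hC fun ρ _ σ _ => ?_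
  rw [← norm_tensorHom, ← tensor_toCompl]
  exact h (ρ, σ)

section Associativity

variable {C : Type} [CStarAlgebra C]

/-- The homomorphism `A ⊙ (B ⊙ C) → A ⊙ (B ⊗ C)` that completes the tensor product of the last two
algebras. -/
def complRight (A B C : Type) [CStarAlgebra A] [CStarAlgebra B] [CStarAlgebra C] :
    A ⊗[ℂ] (B ⊗[ℂ] C) →ₐ[ℂ] A ⊗[ℂ] MinTensor B C :=
  Algebra.TensorProduct.map (AlgHom.id ℂ A) (minNorm B C).toCompl.toAlgHom

/-- The homomorphism `A ⊙ (B ⊙ C) ≅ (A ⊙ B) ⊙ C → (A ⊗ B) ⊙ C` that completes the tensor product of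
the first two algebras. -/
def complLeft (A B C : Type) [CStarAlgebra A] [CStarAlgebra B] [CStarAlgebra C] :
    A ⊗[ℂ] (B ⊗[ℂ] C) →ₐ[ℂ] MinTensor A B ⊗[ℂ] C :=
  (Algebra.TensorProduct.map (minNorm A B).toCompl.toAlgHom (AlgHom.id ℂ C)).comp
    (Algebra.TensorProduct.assoc ℂ ℂ ℂ A B C).symm.toAlgHom

theorem complRight_tmul (a : A) (b : B) (c : C) :
    complRight A B C (a ⊗ₜ (b ⊗ₜ c)) = a ⊗ₜ tmul b c := rfl

theorem complLeft_tmul (a : A) (b : B) (c : C) :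
    complLeft A B C (a ⊗ₜ (b ⊗ₜ c)) = tmul a b ⊗ₜ c := rfl

theorem complRight_sum {κ κ' : Type*} [Fintype κ] [Fintype κ'] (a : κ → A) (b : κ → κ' → B)
    (c : κ' → C) :
    complRight A B C (∑ k, ∑ l, a k ⊗ₜ (b k l ⊗ₜ c l)) = ∑ k, a k ⊗ₜ ∑ l, tmul (b k l) (c l) := by
  simp only [map_sum, complRight_tmul, TensorProduct.tmul_sum]

theorem complLeft_sum {κ κ' : Type*} [Fintype κ] [Fintype κ'] (a : κ → A) (b : κ → κ' → B)
    (c : κ' → C) :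
    complLeft A B C (∑ k, ∑ l, a k ⊗ₜ (b k l ⊗ₜ c l)) = ∑ l, (∑ k, tmul (a k) (b k l)) ⊗ₜ c l := by
  simp only [map_sum, complLeft_tmul, TensorProduct.sum_tmul]
  exact Finset.sum_comm

variable (ρ : Rep A) (σ : Rep B) (τ : Rep C)

/-- The inclusion `H ⊙ (K ⊙ L) → H ⊙ (K ⊗ L)` of Hilbert spaces. -/
def inclRight : ρ.H ⊗[ℂ] (σ.H ⊗[ℂ] τ.H) →ₗᵢ[ℂ] ρ.H ⊗[ℂ] (σ.tensor τ).H :=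
  (σ.incl τ).lTensor ρ.H

/-- The inclusion `H ⊙ (K ⊙ L) ≅ (H ⊙ K) ⊙ L → (H ⊗ K) ⊙ L` of Hilbert spaces. -/
def inclLeft : ρ.H ⊗[ℂ] (σ.H ⊗[ℂ] τ.H) →ₗᵢ[ℂ] (ρ.tensor σ).H ⊗[ℂ] τ.H :=
  ((ρ.incl σ).rTensor τ.H).comp (TensorProduct.assocIsometry ℂ ρ.H σ.H τ.H).symm.toLinearIsometry

theorem inclRight_tmul (h : ρ.H) (v : σ.H ⊗[ℂ] τ.H) :
    inclRight ρ σ τ (h ⊗ₜ v) = h ⊗ₜ σ.incl τ v := rfl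

theorem inclLeft_tmul (h : ρ.H) (k : σ.H) (l : τ.H) :
    inclLeft ρ σ τ (h ⊗ₜ (k ⊗ₜ l)) = ρ.incl σ (h ⊗ₜ k) ⊗ₜ l := rfl

theorem inclRight_zero : inclRight ρ σ τ 0 = 0 := (inclRight ρ σ τ).toLinearMap.map_zero

theorem inclLeft_zero : inclLeft ρ σ τ 0 = 0 := (inclLeft ρ σ τ).toLinearMap.map_zero

theorem denseRange_inclRight : DenseRange (inclRight ρ σ τ) := by
  intro v
  let M : Submodule ℂ (ρ.H ⊗[ℂ] (σ.tensor τ).H) :=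
    (LinearMap.range (inclRight ρ σ τ).toLinearMap).topologicalClosure
  change v ∈ M
  induction v using TensorProduct.induction_on with
  | zero => exact M.zero_mem
  | add v w hv hw => exact M.add_mem hv hw
  | tmul h k =>
    have continuous_tmul : Continuous fun k : (σ.tensor τ).H => h ⊗ₜ[ℂ] k :=
      TensorProduct.continuous_tmul.comp (by fun_prop : Continuous fun k => (h, k))
    refine (σ.denseRange_incl τ).induction_on (p := fun k => h ⊗ₜ[ℂ] k ∈ M) k ?_ fun v => ?_
    · exact (Submodule.isClosed_topologicalClosure _).preimage continuous_tmul
    · exact Submodule.le_topologicalClosure _ ⟨h ⊗ₜ v, rfl⟩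

theorem tensorOp_complRight_tmul (a : A) (b : B) (c : C) (v : ρ.H ⊗[ℂ] (σ.H ⊗[ℂ] τ.H)) :
    ρ.tensorOp (σ.tensor τ) (complRight A B C (a ⊗ₜ (b ⊗ₜ c))) (inclRight ρ σ τ v) =
      inclRight ρ σ τ (TensorProduct.mapL (ρ.π a) (TensorProduct.mapL (σ.π b) (τ.π c)) v) := by
  induction v using TensorProduct.induction_on with
  | zero => simp only [map_zero, inclRight_zero]
  | add v w hv hw => simp only [map_add, hv, hw]
  | tmul h v =>
    rw [complRight_tmul, tensorOp_tmul, inclRight_tmul, TensorProduct.mapL_tmul, tmul,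
      tensor_toCompl_incl, tensorOp_tmul]
    rfl

theorem tensorOp_complLeft_tmul (a : A) (b : B) (c : C) (v : ρ.H ⊗[ℂ] (σ.H ⊗[ℂ] τ.H)) :
    (ρ.tensor σ).tensorOp τ (complLeft A B C (a ⊗ₜ (b ⊗ₜ c))) (inclLeft ρ σ τ v) =
      inclLeft ρ σ τ (TensorProduct.mapL (ρ.π a) (TensorProduct.mapL (σ.π b) (τ.π c)) v) := by
  induction v using TensorProduct.induction_on with
  | zero => simp only [map_zero, inclLeft_zero]
  | add v w hv hw => simp only [map_add, hv, hw]
  | tmul h v =>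
    induction v using TensorProduct.induction_on with
    | zero => simp only [TensorProduct.tmul_zero, map_zero, inclLeft_zero]
    | add v w hv hw => simp only [TensorProduct.tmul_add, map_add, hv, hw]
    | tmul k l =>
      rw [complLeft_tmul, tensorOp_tmul, inclLeft_tmul, TensorProduct.mapL_tmul, tmul,
        tensor_toCompl_incl, tensorOp_tmul]
      rfl

/-- Both sides restrict to the same operator on `H ⊙ (K ⊙ L)`. -/
theorem exists_tensorOp_incl_eq (z : A ⊗[ℂ] (B ⊗[ℂ] C)) (v : ρ.H ⊗[ℂ] (σ.H ⊗[ℂ] τ.H)) :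
    ∃ w, ρ.tensorOp (σ.tensor τ) (complRight A B C z) (inclRight ρ σ τ v) = inclRight ρ σ τ w ∧
      (ρ.tensor σ).tensorOp τ (complLeft A B C z) (inclLeft ρ σ τ v) = inclLeft ρ σ τ w := by
  induction z using TensorProduct.induction_on with
  | zero => exact ⟨0, by simp [inclRight_zero], by simp [inclLeft_zero]⟩
  | add z z' hz hz' =>
    obtain ⟨w, hright, hleft⟩ := hz
    obtain ⟨w', hright', hleft'⟩ := hz'
    exact ⟨w + w', by simp [hright, hright'], by simp [hleft, hleft']⟩
  | tmul a y =>
    induction y using TensorProduct.induction_on with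
    | zero => exact ⟨0, by simp [inclRight_zero], by simp [inclLeft_zero]⟩
    | add y y' hy hy' =>
      obtain ⟨w, hright, hleft⟩ := hy
      obtain ⟨w', hright', hleft'⟩ := hy'
      exact ⟨w + w', by simp [TensorProduct.tmul_add, hright, hright'],
        by simp [TensorProduct.tmul_add, hleft, hleft']⟩
    | tmul b c =>
      exact ⟨_, ρ.tensorOp_complRight_tmul σ τ a b c v, ρ.tensorOp_complLeft_tmul σ τ a b c v⟩

theorem norm_tensorOp_complRight_le (z : A ⊗[ℂ] (B ⊗[ℂ] C)) :
    ‖ρ.tensorOp (σ.tensor τ) (complRight A B C z)‖ ≤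
      ‖(ρ.tensor σ).tensorOp τ (complLeft A B C z)‖ := by
  refine ContinuousLinearMap.opNorm_le_bound _ (ContinuousLinearMap.opNorm_nonneg _) fun v => ?_
  induction v using (denseRange_inclRight ρ σ τ).induction_on with
  | hp => exact isClosed_le (by fun_prop) (by fun_prop)
  | ih v =>
    obtain ⟨w, hright, hleft⟩ := exists_tensorOp_incl_eq ρ σ τ z v
    have le_opNorm := ((ρ.tensor σ).tensorOp τ (complLeft A B C z)).le_opNorm (inclLeft ρ σ τ v)
    rw [hleft, LinearIsometry.norm_map, LinearIsometry.norm_map] at le_opNorm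
    rwa [hright, LinearIsometry.norm_map, LinearIsometry.norm_map]

end Associativity

end Rep

namespace MatPair

variable {N : ℕ} (P Q R : MatPair N)

/-- The evaluation of *-polynomials at the entries of `P ⊥ Q ⊥ R` in the algebraic tensor
product. -/
def evTensor₃ : FreeStar (Fin N × Fin N) →⋆ₐ[ℂ] P.D ⊗[ℂ] (Q.D ⊗[ℂ] R.D) :=
  FreeStar.eval fun ij => ∑ k, ∑ l, P.M ij.1 k ⊗ₜ (Q.M k l ⊗ₜ R.M l ij.2)

theorem star_oprod_M (i j : Fin N) :
    star ((P.oprod Q).M i j) = ∑ k, tmul (star (P.M i k)) (star (Q.M k j)) := by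
  change star (∑ k, tmul (P.M i k) (Q.M k j)) = _
  exact (star_sum _ _).trans (Finset.sum_congr rfl fun _ _ => star_tmul _ _)

theorem star_sum_tmul_tmul (i j : Fin N) :
    star (∑ k, ∑ l, P.M i k ⊗ₜ[ℂ] (Q.M k l ⊗ₜ[ℂ] R.M l j)) =
      ∑ k, ∑ l, star (P.M i k) ⊗ₜ[ℂ] (star (Q.M k l) ⊗ₜ[ℂ] star (R.M l j)) := by
  simp only [star_sum, TensorProduct.star_tmul]

theorem complRight_evTensor₃ (f : FreeStar (Fin N × Fin N)) :
    Rep.complRight P.D Q.D R.D (P.evTensor₃ Q R f) = P.evTensor (Q.oprod R) f := by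
  have comp_eval := FreeStar.algHom_comp_eval
    (f := fun ij : Fin N × Fin N => ∑ k, ∑ l, P.M ij.1 k ⊗ₜ[ℂ] (Q.M k l ⊗ₜ[ℂ] R.M l ij.2))
    (g := fun ij : Fin N × Fin N => ∑ k, P.M ij.1 k ⊗ₜ[ℂ] ∑ l, tmul (Q.M k l) (R.M l ij.2))
    (Rep.complRight P.D Q.D R.D) (fun ij => Rep.complRight_sum _ _ _) fun ij => by
      rw [star_sum_tmul_tmul, Rep.complRight_sum, star_sum]
      exact Finset.sum_congr rfl fun k _ => congrArg (star (P.M ij.1 k) ⊗ₜ[ℂ] ·)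
        (star_oprod_M Q R k ij.2).symm
  exact DFunLike.congr_fun comp_eval f

theorem complLeft_evTensor₃ (f : FreeStar (Fin N × Fin N)) :
    Rep.complLeft P.D Q.D R.D (P.evTensor₃ Q R f) = (P.oprod Q).evTensor R f := by
  have comp_eval := FreeStar.algHom_comp_eval
    (f := fun ij : Fin N × Fin N => ∑ k, ∑ l, P.M ij.1 k ⊗ₜ[ℂ] (Q.M k l ⊗ₜ[ℂ] R.M l ij.2))
    (g := fun ij : Fin N × Fin N => ∑ l, (∑ k, tmul (P.M ij.1 k) (Q.M k l)) ⊗ₜ[ℂ] R.M l ij.2)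
    (Rep.complLeft P.D Q.D R.D) (fun ij => Rep.complLeft_sum _ _ _) fun ij => by
      rw [star_sum_tmul_tmul, Rep.complLeft_sum, star_sum]
      exact Finset.sum_congr rfl fun l _ => congrArg (· ⊗ₜ[ℂ] star (R.M l ij.2))
        (star_oprod_M P Q ij.1 l).symm
  exact DFunLike.congr_fun comp_eval f

theorem oprod_oprod_le : P.oprod (Q.oprod R) ≤ (P.oprod Q).oprod R := fun f => by
  rw [norm_ev_oprod, norm_ev_oprod]
  refine Rep.minNorm_le_of_separating Rep.separating_univ Rep.separating_tensor _
    ((minNorm _ _).nonneg _) ?_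
  rintro ρ - _ ⟨σ, τ, rfl⟩
  rw [← complRight_evTensor₃, ← complLeft_evTensor₃]
  exact (ρ.norm_tensorOp_complRight_le σ τ _).trans (Rep.norm_tensorOp_le_minNorm _ _ _)

end MatPair

section UniversalProperty

variable {X : Type} (rel : ∀ (D : Type) [CStarAlgebra D], (X → D) → Prop)
  (hrel : ∀ x, ∃ C : ℝ, ∀ r : Realisation X rel, ‖r.f x‖ ≤ C)

theorem exists_univCStar_lift (r : Realisation X rel) :
    ∃ φ : UnivCStar rel hrel →⋆ₐ[ℂ] r.D, ∀ x, φ (univGen rel hrel x) = r.f x := by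
  obtain ⟨φ, hφ⟩ := (univSeminorm rel hrel).exists_lift (FreeStar.eval r.f) fun x =>
    le_ciSup (FreeStar.bddAbove_eval (fun r : Realisation X rel => r.f) hrel x) r
  exact ⟨φ, fun x => (hφ _).trans (FreeStar.eval_gen _ _)⟩

end UniversalProperty

theorem exists_arrow_SNplus {N : ℕ} {P : MatPair N} (hP : IsMagic P.M) :
    Nonempty ((SNplus N).Arrow P) := by
  obtain ⟨φ, hφ⟩ := exists_univCStar_lift
    (fun (D : Type) [CStarAlgebra D] (u : Fin N × Fin N → D) =>
      IsMagic (Matrix.of fun i j => u (i, j)))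
    (fun ij => ⟨1, fun r => r.holds.norm_le_one ij.1 ij.2⟩) ⟨P.D, fun ij => P.M ij.1 ij.2, hP⟩
  exact ⟨φ, fun i j => hφ (i, j)⟩

theorem exists_twoProj_lift {D : Type} [CStarAlgebra D] {p q : D} (hp : IsStarProjection p)
    (hq : IsStarProjection q) : ∃ φ : TwoProj →⋆ₐ[ℂ] D, φ projP = p ∧ φ projQ = q := by
  obtain ⟨φ, hφ⟩ := exists_univCStar_lift
    (fun (D : Type) [CStarAlgebra D] (f : Fin 2 → D) => ∀ x, IsStarProjection (f x))
    (fun x => ⟨1, fun r => (r.holds x).norm_le⟩) ⟨D, ![p, q], Fin.forall_fin_two.2 ⟨hp, hq⟩⟩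
  exact ⟨φ, hφ 0, hφ 1⟩

open scoped ComplexOrder in
theorem not_commute_projP_projQ : ¬ Commute projP projQ := by
  let P : CStarMatrix (Fin 2) (Fin 2) ℂ := CStarMatrix.ofMatrix !![1, 0; 0, 0]
  let Q : CStarMatrix (Fin 2) (Fin 2) ℂ := CStarMatrix.ofMatrix !![1 / 2, 1 / 2; 1 / 2, 1 / 2]
  have hP : IsStarProjection P := by
    constructor <;> ext i j <;> fin_cases i <;> fin_cases j <;>
      norm_num [P, CStarMatrix.mul_apply, CStarMatrix.star_apply]
  have hQ : IsStarProjection Q := by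
    constructor <;> ext i j <;> fin_cases i <;> fin_cases j <;>
      norm_num [Q, CStarMatrix.mul_apply, CStarMatrix.star_apply]
  obtain ⟨φ, hφP, hφQ⟩ := exists_twoProj_lift hP hQ
  intro h
  have commute_P_Q : Commute P Q := hφP ▸ hφQ ▸ h.map φ
  have entry := congrFun (congrFun commute_P_Q.eq 0) 1
  norm_num [P, Q, CStarMatrix.mul_apply] at entry

section Slices

variable {A B : Type} [CStarAlgebra A] [CStarAlgebra B]

/-- The embedding `b ↦ 1 ⊗ b`. -/
def tmulRight (A : Type) {B : Type} [CStarAlgebra A] [CStarAlgebra B] : B →⋆ₐ[ℂ] MinTensor A B where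
  __ := (minNorm A B).toCompl.toAlgHom.comp Algebra.TensorProduct.includeRight
  map_star' b := by
    change tmul 1 (star b) = star (tmul 1 b)
    rw [star_tmul, star_one]

/-- The embedding `a ↦ a ⊗ 1`. -/
def tmulLeft {A : Type} (B : Type) [CStarAlgebra A] [CStarAlgebra B] : A →⋆ₐ[ℂ] MinTensor A B where
  __ := (minNorm A B).toCompl.toAlgHom.comp Algebra.TensorProduct.includeLeft
  map_star' a := by
    change tmul (star a) 1 = star (tmul a 1)
    rw [star_tmul, star_one]

theorem norm_apply_mul_norm_apply_le (ρ : Rep A) (σ : Rep B) (a : A) (b : B) (v : ρ.H)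
    (w : σ.H) : ‖ρ.π a v‖ * ‖σ.π b w‖ ≤ ‖tmul a b‖ * (‖v‖ * ‖w‖) := by
  calc ‖ρ.π a v‖ * ‖σ.π b w‖ = ‖ρ.tensorOp σ (a ⊗ₜ b) (v ⊗ₜ w)‖ := by
        rw [Rep.tensorOp_tmul, TensorProduct.mapL_tmul, TensorProduct.norm_tmul]
    _ ≤ (minNorm A B).toFun (a ⊗ₜ b) * ‖v ⊗ₜ[ℂ] w‖ :=
        ContinuousLinearMap.le_of_opNorm_le _ (ρ.norm_tensorOp_le_minNorm σ _) _
    _ = ‖tmul a b‖ * (‖v‖ * ‖w‖) := by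
        rw [TensorProduct.norm_tmul, ← CStarSeminorm.norm_coe]
        rfl

theorem tmul_ne_zero {a : A} {b : B} (ha : a ≠ 0) (hb : b ≠ 0) : tmul a b ≠ 0 := by
  intro h
  refine ha (Rep.separating_univ a fun ρ _ => ContinuousLinearMap.ext fun v => ?_)
  by_contra hv
  refine hb (Rep.separating_univ b fun σ _ => ContinuousLinearMap.ext fun w => ?_)
  have norm_mul_le := norm_apply_mul_norm_apply_le ρ σ a b v w
  rw [h, norm_zero, zero_mul] at norm_mul_le
  exact norm_le_zero_iff.1 (nonpos_of_mul_nonpos_right norm_mul_le (norm_pos_iff.2 hv))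

theorem tmulRight_injective [Nontrivial A] :
    Function.Injective (tmulRight A : B →⋆ₐ[ℂ] MinTensor A B) :=
  (injective_iff_map_eq_zero _).2 fun _ hb =>
    by_contra fun h => tmul_ne_zero (one_ne_zero (α := A)) h hb

theorem tmulLeft_injective [Nontrivial B] :
    Function.Injective (tmulLeft B : A →⋆ₐ[ℂ] MinTensor A B) :=
  (injective_iff_map_eq_zero _).2 fun _ ha =>
    by_contra fun h => tmul_ne_zero h (one_ne_zero (α := B)) ha

end Slices

namespace MatPair

variable {N : ℕ}

section Permutations

/-- The pair `(ℂ, (δ_{i,σ(j)}))` of a permutation matrix. -/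
def permPair (σ : Equiv.Perm (Fin N)) : MatPair N :=
  ⟨ℂ, Matrix.of fun i j => if i = σ j then 1 else 0⟩

theorem permPair_M (σ : Equiv.Perm (Fin N)) (i j : Fin N) :
    (permPair σ).M i j = if i = σ j then (1 : ℂ) else 0 := rfl

theorem permPair_one : permPair (1 : Equiv.Perm (Fin N)) = ⟨ℂ, 1⟩ := rfl

theorem oprod_permPair_M (P : MatPair N) (σ : Equiv.Perm (Fin N)) (i j : Fin N) :
    (P.oprod (permPair σ)).M i j = tmul (P.M i (σ j)) (1 : ℂ) := by
  change ∑ k, tmul (P.M i k) ((permPair σ).M k j) = _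
  rw [Finset.sum_eq_single (σ j)]
  · rw [permPair_M, if_pos rfl]
    rfl
  · intro k _ hk
    rw [permPair_M, if_neg hk]
    exact congrArg (minNorm P.D ℂ).toCompl (TensorProduct.tmul_zero ..)
  · exact fun h => (h (Finset.mem_univ _)).elim

theorem permPair_one_oprod_M (P : MatPair N) (i j : Fin N) :
    ((permPair 1).oprod P).M i j = tmul (1 : ℂ) (P.M i j) := by
  change ∑ k, tmul ((permPair 1).M i k) (P.M k j) = _
  rw [Finset.sum_eq_single i]
  · exact congrArg (tmul · (P.M i j)) (if_pos rfl : (permPair 1).M i i = (1 : ℂ))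
  · intro k _ hk
    exact (congrArg (tmul · (P.M k j)) (if_neg hk.symm : (permPair 1).M i k = (0 : ℂ))).trans
      (zero_tmul _)
  · exact fun h => (h (Finset.mem_univ _)).elim

theorem le_one_oprod (P : MatPair N) : P ≤ (permPair 1).oprod P :=
  Arrow.le_of_injective ⟨tmulRight ℂ, fun i j => (permPair_one_oprod_M P i j).symm⟩
    tmulRight_injective

theorem le_oprod_one (P : MatPair N) : P ≤ P.oprod (permPair 1) :=
  Arrow.le_of_injective ⟨tmulLeft ℂ, fun i j => (oprod_permPair_M P 1 i j).symm⟩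
    tmulLeft_injective

theorem permPair_mul_le (σ τ : Equiv.Perm (Fin N)) :
    permPair (σ * τ) ≤ (permPair σ).oprod (permPair τ) :=
  Arrow.le_of_injective ⟨tmulLeft ℂ, fun i j => (oprod_permPair_M (permPair σ) τ i j).symm⟩
    tmulLeft_injective

theorem permPair_mul_prod_le_foldl {l : List (Equiv.Perm (Fin N))} {Ps : List (MatPair N)}
    (h : List.Forall₂ (fun σ P => permPair σ ≤ P) l Ps) {σ : Equiv.Perm (Fin N)} {P : MatPair N}
    (hP : permPair σ ≤ P) : permPair (σ * l.prod) ≤ Ps.foldl oprod P := by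
  induction h generalizing σ P with
  | nil => simpa using hP
  | cons hQ _ ih =>
    rw [List.prod_cons, ← mul_assoc]
    exact ih ((permPair_mul_le _ _).trans (oprod_le_oprod hP hQ))

theorem permPair_prod_le_listProd {l : List (Equiv.Perm (Fin N))} {Ps : List (MatPair N)}
    (h : List.Forall₂ (fun σ P => permPair σ ≤ P) l Ps) : permPair l.prod ≤ listProd Ps := by
  cases h with
  | nil => exact permPair_one.le
  | cons hP h =>
    rw [List.prod_cons]
    exact permPair_mul_prod_le_foldl h hP

theorem permPair_prod_le_pow {P : MatPair N} {l : List (Equiv.Perm (Fin N))}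
    (h : ∀ σ ∈ l, permPair σ ≤ P) : permPair l.prod ≤ P.pow l.length := by
  refine permPair_prod_le_listProd (List.forall₂_iff_get.2 ⟨by simp, fun i hi _ => ?_⟩)
  simpa using h _ (List.getElem_mem hi)

/-- Shorter products are padded with identity matrices. -/
theorem permPair_prod_le_pow_of_length_le {P : MatPair N} (h_one : permPair 1 ≤ P)
    {l : List (Equiv.Perm (Fin N))} (h : ∀ σ ∈ l, permPair σ ≤ P) {n : ℕ} (hn : l.length ≤ n) :
    permPair l.prod ≤ P.pow n := by
  have pow_le := permPair_prod_le_pow (P := P) (l := l ++ List.replicate (n - l.length) 1)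
    fun σ hσ => (List.mem_append.1 hσ).elim (h σ) fun hσ => List.eq_of_mem_replicate hσ ▸ h_one
  simpa [hn] using pow_le

theorem le_foldl_of_one_le {l : List (MatPair N)} (h : ∀ Q ∈ l, permPair 1 ≤ Q)
    {P P' : MatPair N} (hP : P ≤ P') : P ≤ l.foldl oprod P' := by
  induction l generalizing P' with
  | nil => exact hP
  | cons Q l ih =>
    exact ih (fun R hR => h R (List.mem_cons_of_mem _ hR))
      ((le_oprod_one P).trans (oprod_le_oprod hP (h Q List.mem_cons_self)))

theorem le_listProd_of_mem {l : List (MatPair N)} (h : ∀ Q ∈ l, permPair 1 ≤ Q)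
    {P : MatPair N} (hP : P ∈ l) : P ≤ listProd l := by
  obtain ⟨l₁, l₂, rfl⟩ := List.append_of_mem hP
  have h₂ : ∀ Q ∈ l₂, permPair 1 ≤ Q := fun Q hQ => h Q (by simp [hQ])
  cases l₁ with
  | nil => exact le_foldl_of_one_le h₂ le_rfl
  | cons Q l₁ =>
    change P ≤ (l₁ ++ P :: l₂).foldl oprod Q
    rw [List.foldl_append, List.foldl_cons]
    have one_le : permPair 1 ≤ l₁.foldl oprod Q :=
      le_foldl_of_one_le (fun R hR => h R (by simp [hR])) (h Q (by simp))
    exact le_foldl_of_one_le h₂ ((le_one_oprod P).trans (oprod_le_oprod one_le le_rfl))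

theorem ev_SN_apply (f : FreeStar (Fin N × Fin N)) (σ : Equiv.Perm (Fin N)) :
    ((SN N).ev f : Equiv.Perm (Fin N) → ℂ) σ = (permPair σ).ev f :=
  FreeStar.map_eval (D := Equiv.Perm (Fin N) → ℂ) (Pi.evalStarAlgHom ℂ (fun _ => ℂ) σ)
    (fun _ => rfl) f

theorem SN_le {P : MatPair N} (h : ∀ σ, permPair σ ≤ P) : SN N ≤ P := fun f =>
  (pi_norm_le_iff_of_nonneg (norm_nonneg _)).2 fun σ =>
    (congrArg norm (ev_SN_apply f σ)).trans_le (h σ f)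

end Permutations

theorem pow_add_two (P : MatPair N) (n : ℕ) : P.pow (n + 2) = (P.pow (n + 1)).oprod P := by
  change (List.replicate (n + 1) P).foldl oprod P = ((List.replicate n P).foldl oprod P).oprod P
  rw [List.replicate_succ', List.foldl_append]
  rfl

theorem pow_oprod_pow_le (P : MatPair N) (n m : ℕ) :
    (P.pow (n + 1)).oprod (P.pow (m + 1)) ≤ P.pow (n + m + 2) := by
  induction m with
  | zero => exact (pow_add_two P n).ge
  | succ m ih =>
    rw [pow_add_two P m, ← add_assoc, pow_add_two P (n + m + 1)]
    exact (oprod_oprod_le _ _ _).trans (oprod_le_oprod ih le_rfl)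

theorem commute_M_of_le {P Q : MatPair N} (hPQ : P ≤ Q) {i j k l : Fin N}
    (h : Commute (Q.M i j) (Q.M k l)) : Commute (P.M i j) (P.M k l) := by
  rw [← ev_gen, ← ev_gen] at h ⊢
  rw [commute_iff_lie_eq, Ring.lie_def, ← map_mul, ← map_mul, ← map_sub] at h ⊢
  exact norm_le_zero_iff.1 ((hPQ _).trans_eq (norm_eq_zero.2 h))

end MatPair

namespace IsMagic

variable {N : ℕ} {D : Type*} [CStarAlgebra D] {u : Matrix (Fin N) (Fin N) D}

theorem transpose (hu : IsMagic u) : IsMagic u.transpose :=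
  ⟨fun i j => hu.proj j i, hu.col, hu.row⟩

theorem map_star (hu : IsMagic u) : u.map star = u :=
  Matrix.ext fun i j => (hu.proj i j).isSelfAdjoint

theorem mul_transpose (hu : IsMagic u) : u * u.transpose = 1 := by
  ext i j
  rw [Matrix.mul_apply, Matrix.one_apply]
  split_ifs with h
  · subst h
    rw [← hu.row i]
    exact Finset.sum_congr rfl fun k _ => (hu.proj i k).isIdempotentElem
  · exact Finset.sum_eq_zero fun k _ => hu.transpose.mul_eq_zero k h

theorem mem_unitary (hu : IsMagic u) : u ∈ unitary (Matrix (Fin N) (Fin N) D) := by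
  have star_eq : star u = u.transpose := congrArg Matrix.transpose hu.map_star
  rw [Unitary.mem_iff, star_eq]
  exact ⟨hu.transpose.mul_transpose, hu.mul_transpose⟩

theorem isUnit (hu : IsMagic u) : IsUnit u :=
  ⟨⟨u, u.transpose, hu.mul_transpose, hu.transpose.mul_transpose⟩, rfl⟩

end IsMagic

namespace MatPair

variable {N : ℕ} {P : ℕ → MatPair N} {hP : ∀ i j, ∃ C : ℝ, ∀ n, ‖(P n).M i j‖ ≤ C}

theorem invLimit_ev_eq {f g : FreeStar (Fin N × Fin N)} (h : ∀ n, (P n).ev f = (P n).ev g) :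
    (invLimit P hP).ev f = (invLimit P hP).ev g := by
  rw [← sub_eq_zero, ← norm_eq_zero, ← map_sub, norm_invLimit_ev]
  simp [h]

theorem isMagic_invLimit (h : ∀ n, IsMagic (P n).M) : IsMagic (invLimit P hP).M where
  proj i j := by
    constructor
    · rw [← ev_gen, IsIdempotentElem, ← map_mul]
      refine invLimit_ev_eq fun n => ?_
      rw [map_mul, ev_gen]
      exact ((h n).proj i j).isIdempotentElem
    · rw [← ev_gen, isSelfAdjoint_iff, ← map_star]
      refine invLimit_ev_eq fun n => ?_
      rw [map_star, ev_gen]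
      exact ((h n).proj i j).isSelfAdjoint
  row i := by
    simp only [← ev_gen, ← map_sum]
    rw [← map_one (invLimit P hP).ev]
    refine invLimit_ev_eq fun n => ?_
    simp only [map_sum, ev_gen, map_one]
    exact (h n).row i
  col j := by
    simp only [← ev_gen, ← map_sum]
    rw [← map_one (invLimit P hP).ev]
    refine invLimit_ev_eq fun n => ?_
    simp only [map_sum, ev_gen, map_one]
    exact (h n).col j

theorem ev_mem_entryAlg (Q : MatPair N) (f : FreeStar (Fin N × Fin N)) : Q.ev f ∈ Q.entryAlg :=
  FreeStar.eval_mem Q.entryAlg.toSubalgebra (fun _ => Q.mem_entryAlg _ _)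
    (fun _ => star_mem (S := StarSubalgebra ℂ Q.D) (Q.mem_entryAlg _ _)) f

theorem entryAlg_invLimit : (invLimit P hP).entryAlg = ⊤ := by
  refine eq_top_iff.2 fun a _ => ?_
  have closure_range_subset :
      closure (Set.range (invLimit P hP).ev) ⊆ (invLimit P hP).entryAlg :=
    closure_minimal (Set.range_subset_iff.2 (ev_mem_entryAlg _))
      (StarSubalgebra.isClosed_topologicalClosure _)
  exact closure_range_subset (dense_range_invLimit_ev P hP a)

theorem isCMQG_invLimit (h_magic : ∀ n, IsMagic (P n).M)
    (h_oprod : ∀ n m, (P n).oprod (P m) ≤ invLimit P hP) : (invLimit P hP).IsCMQG where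
  generated := entryAlg_invLimit
  unitary := (isMagic_invLimit h_magic).mem_unitary
  invertible := by
    rw [(isMagic_invLimit h_magic).map_star]
    exact (isMagic_invLimit h_magic).isUnit
  comul := by
    obtain ⟨Δ⟩ := exists_arrow_of_le_invLimit P hP (invLimit_oprod_invLimit_le h_oprod)
    exact ⟨Δ.hom, Δ.map_entry⟩

end MatPair

theorem map_matR {N : ℕ} {D D' : Type*} [Ring D] [Ring D'] (φ : D →+* D') (p q : D)
    (a b c d : Fin N) : (matR p q a b c d).map φ = matR (φ p) (φ q) a b c d := by
  ext i j
  simp only [matR, Matrix.map_apply, Matrix.of_apply, apply_ite φ, map_sub, map_one, map_zero]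

theorem matR_one_one {N : ℕ} {D : Type*} [Ring D] (a b c d : Fin N) :
    matR (1 : D) 1 a b c d = 1 := by
  ext i j
  simp [matR, Matrix.one_apply]

theorem matR_zero_one {N : ℕ} {D : Type*} [Ring D] {a b : Fin N} (hab : a ≠ b) (c d : Fin N) :
    matR (0 : D) 1 a b c d = Matrix.of fun i j => if i = Equiv.swap a b j then 1 else 0 := by
  ext i j
  simp only [matR, Matrix.of_apply, Equiv.swap_apply_def]
  grind

namespace MatPair

variable {N : ℕ}

theorem mk_matR_le_pairR {D : Type} [CStarAlgebra D] {p q : D} (hp : IsStarProjection p)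
    (hq : IsStarProjection q) (a b c d : Fin N) : ⟨D, matR p q a b c d⟩ ≤ pairR a b c d := by
  obtain ⟨φ, rfl, rfl⟩ := exists_twoProj_lift hp hq
  exact Arrow.le ⟨φ, fun i j => congrFun₂ (map_matR (φ : TwoProj →+* D) projP projQ a b c d) i j⟩

theorem permPair_one_le_pairR (a b c d : Fin N) : permPair 1 ≤ pairR a b c d := by
  rw [permPair_one, ← matR_one_one a b c d]
  exact mk_matR_le_pairR (IsStarProjection.one ℂ) (IsStarProjection.one ℂ) a b c d

theorem permPair_swap_le_pairR {a b : Fin N} (hab : a ≠ b) (c d : Fin N) :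
    permPair (Equiv.swap a b) ≤ pairR a b c d := by
  rw [permPair, ← matR_zero_one hab c d]
  exact mk_matR_le_pairR (IsStarProjection.zero ℂ) (IsStarProjection.one ℂ) a b c d

theorem not_commute_pairR_M {a b c d : Fin N} (h : [a, b, c, d].Nodup) :
    ¬ Commute ((pairR a b c d).M a a) ((pairR a b c d).M c c) := by
  have hp : matR projP projQ a b c d a a = projP := by simp [matR]
  have hq : matR projP projQ a b c d c c = projQ := by
    have hca : c ≠ a := by grind
    have hcb : c ≠ b := by grind
    simp [matR, hca, hcb]
  change ¬ Commute (matR projP projQ a b c d a a) (matR projP projQ a b c d c c)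
  rw [hp, hq]
  exact not_commute_projP_projQ

end MatPair

namespace StartData

open MatPair

variable {N : ℕ} (s : StartData N)

theorem R_le_listProd {a b : Fin N} (hab : a < b) :
    s.R (a, b) ≤ listProd (s.pairs.map s.R) := by
  refine le_listProd_of_mem (fun P hP => ?_) (List.mem_map_of_mem ((s.mem_pairs (a, b)).2 hab))
  obtain ⟨ab, -, rfl⟩ := List.mem_map.1 hP
  exact permPair_one_le_pairR _ _ _ _

theorem permPair_swap_le_listProd {σ : Equiv.Perm (Fin N)} (hσ : σ.IsSwap) :
    permPair σ ≤ listProd (s.pairs.map s.R) := by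
  obtain ⟨a, b, hab, rfl⟩ := hσ
  rcases lt_or_gt_of_ne hab with hlt | hgt
  · exact (permPair_swap_le_pairR hab _ _).trans (s.R_le_listProd hlt)
  · rw [Equiv.swap_comm]
    exact (permPair_swap_le_pairR hab.symm _ _).trans (s.R_le_listProd hgt)

theorem Binf_isMagic : IsMagic s.Binf.M := isMagic_invLimit fun n => s.B_magic (n + 1)

theorem pow_B₁_le_Binf (n : ℕ) : s.B₁.pow (n + 1) ≤ s.Binf :=
  (le_cut _).trans (le_invLimit (fun n => s.B (n + 1)) _ n)

theorem Binf_isCMQG : s.Binf.IsCMQG :=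
  isCMQG_invLimit (fun n => s.B_magic (n + 1)) fun n m =>
    calc (s.B (n + 1)).oprod (s.B (m + 1))
      _ ≤ (s.B₁.pow (n + 1)).oprod (s.B₁.pow (m + 1)) := oprod_le_oprod (cut_le _) (cut_le _)
      _ ≤ s.B₁.pow (n + m + 2) := pow_oprod_pow_le _ n m
      _ ≤ s.Binf := s.pow_B₁_le_Binf (n + m + 1)

section Nontrivial

variable [Nontrivial (Fin N)]

theorem permPair_one_le_listProd : permPair 1 ≤ listProd (s.pairs.map s.R) := by
  obtain ⟨a, b, hab⟩ := exists_pair_lt (Fin N)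
  exact (permPair_one_le_pairR _ _ _ _).trans (s.R_le_listProd hab)

theorem L_ne_zero : s.L ≠ 0 := by
  intro hL
  obtain ⟨a, b, hab⟩ := exists_pair_ne (Fin N)
  obtain ⟨l, hl, -, hprod⟩ := s.prod_of_swaps (Equiv.swap a b)
  rw [hL, Nat.le_zero, List.length_eq_zero_iff] at hl
  rw [hl, List.prod_nil, eq_comm, Equiv.swap_eq_one_iff] at hprod
  exact hab hprod

theorem permPair_le_Binf (σ : Equiv.Perm (Fin N)) : permPair σ ≤ s.Binf := by
  obtain ⟨l, hl, h_swap, rfl⟩ := s.prod_of_swaps σ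
  calc permPair l.prod
    _ ≤ (listProd (s.pairs.map s.R)).pow s.L :=
      permPair_prod_le_pow_of_length_le s.permPair_one_le_listProd
        (fun τ hτ => s.permPair_swap_le_listProd (h_swap τ hτ)) hl
    _ ≤ s.B₁ := le_cut _
    _ ≤ s.Binf := s.pow_B₁_le_Binf 0

theorem R_le_Binf {a b : Fin N} (hab : a < b) : s.R (a, b) ≤ s.Binf := by
  have one_le : ∀ P ∈ List.replicate s.L (listProd (s.pairs.map s.R)), permPair 1 ≤ P :=
    fun _ hP => List.eq_of_mem_replicate hP ▸ s.permPair_one_le_listProd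
  calc s.R (a, b)
    _ ≤ listProd (s.pairs.map s.R) := s.R_le_listProd hab
    _ ≤ (listProd (s.pairs.map s.R)).pow s.L :=
      le_listProd_of_mem one_le (List.mem_replicate.2 ⟨s.L_ne_zero, rfl⟩)
    _ ≤ s.B₁ := le_cut _
    _ ≤ s.Binf := s.pow_B₁_le_Binf 0

theorem exists_not_commute_Binf : ∃ x y : s.Binf.D, ¬ Commute x y := by
  obtain ⟨a, b, hab⟩ := exists_pair_lt (Fin N)
  exact ⟨_, _, fun h => not_commute_pairR_M (s.distinct a b hab)
    (commute_M_of_le (s.R_le_Binf hab) h)⟩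

theorem exists_arrow_SN : Nonempty (s.Binf.Arrow (SN N)) :=
  exists_arrow_of_le_invLimit _ _ (SN_le s.permPair_le_Binf)

theorem not_injective_arrow_SN (φ : s.Binf.Arrow (SN N)) :
    ¬ Function.Injective φ.hom := by
  intro h
  obtain ⟨x, y, hxy⟩ := s.exists_not_commute_Binf
  refine hxy (h ?_)
  rw [map_mul, map_mul]
  exact mul_comm (G := Equiv.Perm (Fin N) → ℂ) _ _

end Nontrivial

end StartData

end QPerm

end

theorem mainTheorem2 (N : ℕ) (hN : 4 ≤ N) (s : QPerm.StartData N) :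
    s.Binf.IsCMQG ∧
      Nonempty ((QPerm.SNplus N).Arrow s.Binf) ∧
      ∃ φ : s.Binf.Arrow (QPerm.SN N), ¬ Function.Injective φ.hom := by
  have : Nontrivial (Fin N) := Fin.nontrivial_iff_two_le.2 (by lia)
  obtain ⟨φ⟩ := s.exists_arrow_SN
  exact ⟨s.Binf_isCMQG, QPerm.exists_arrow_SNplus s.Binf_isMagic, φ, s.not_injective_arrow_SN φ⟩
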